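/- There is an absolute constant $C>0$ such that for every $n\in\mathbb{N}$ there exists an assignment $W(n)$ of nonnegative real weights to the edges of the finite grid graph on $[n]\times[n]$ (two vertices being adjacent exactly when they are at Euclidean distance $1$) such that for all $u,v\in[n]\times[n]$, \[ \|u-v\|_2-1\;\le\;\operatorname{dist}_{W(n)}(u,v)\;\le\;\|u-v\|_2+C\,\|u-v\|_2^{8/9}, \] where $\operatorname{dist}_{W(n)}(u,v)$ is the shortest-path distance, i.e. the minimum total weight of a path from $u$ to $v$ in the grid graph on $[n]\times[n]$. -/

import Mathlib

open scoped NNReal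

namespace SquishyGrid

/-- The `n × n` square grid graph: the vertices are the pairs `(x, y)` with `x, y ∈ {0, …, n - 1}`
(a translate of `[n] × [n]`), and two vertices are adjacent iff they agree in one coordinate and
differ by exactly one in the other. -/
abbrev grid (n : ℕ) : SimpleGraph (Fin n × Fin n) :=
  (SimpleGraph.pathGraph n).boxProd (SimpleGraph.pathGraph n)

/-- The position of a grid vertex in the Euclidean plane. -/
noncomputable def pos {n : ℕ} (u : Fin n × Fin n) : EuclideanSpace ℝ (Fin 2) :=
  !₂[((u.1 : ℕ) : ℝ), ((u.2 : ℕ) : ℝ)]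

section WeightedGraph

variable {V : Type*} {G : SimpleGraph V}

/-- The total weight of a walk, edges being counted with multiplicity. Only the values of `W` at
edges of `G` enter. -/
def walkWeight (W : Sym2 V → ℝ≥0) {u v : V} (p : G.Walk u v) : ℝ≥0 :=
  (p.edges.map W).sum

/-- The weighted shortest-path distance: the infimum of the weights of the walks from `u` to `v`
(in the grid, which is connected, this is an infimum over a non-empty set of nonnegative reals). -/
noncomputable def wdist (G : SimpleGraph V) (W : Sym2 V → ℝ≥0) (u v : V) : ℝ :=
  ⨅ p : G.Walk u v, (walkWeight W p : ℝ)

end WeightedGraph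

/-- Any two vertices of the grid are joined by a walk, so `wdist` is never an infimum over the
empty set there. -/
theorem nonempty_grid_walk {n : ℕ} (u v : Fin n × Fin n) : Nonempty ((grid n).Walk u v) :=
  ((SimpleGraph.pathGraph_preconnected n).boxProd (SimpleGraph.pathGraph_preconnected n)) u v

end SquishyGrid

/-!
The weights come from a system of straight roads. A road is a line together with lattice points
within `√2 / 2` of it, and different roads have no lattice point in common. Each such point is
projected to its line, every other lattice point stays where it is, and `LineSystem.foot` is the
resulting point of the plane. An edge inside a road costs the distance of the projections of its
ends, and every other edge costs `4`, which exceeds that distance by more than `1`. So a walk that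
uses an edge outside the roads weighs at least `1` more than the distance of the projections of its
ends, and a walk inside one road pays for each of its steps the projection of that step to the line;
either way the weight is at least the Euclidean distance minus `1`
(`LineSystem.norm_sub_one_le_wdist`).

For the upper bound write `n = θ 2 ^ (18 Q)` with `1 ≤ θ ≤ 2 ^ 18`. The cells of level `q ≤ Q` are
the squares of side `D = θ 2 ^ (18 q)` of a nested family of square grids. Each of them gets its own
roads in `4 ^ q` equidistributed directions, and parallel roads have a spacing of about
`s = θ 2 ^ (16 q) = D / 4 ^ q`, which is of order `D ^ (8 / 9)`. Roads are placed one after the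
other, from the highest level down, and a road of level `q` leaves out (is blocked at) all points
whose cell of level `q / 2` meets a road placed before. Hence roads do not cross at all. Two things
make this work.

* A cell of level `q` meets at most one road of level `2 q` or more, because the cells in which
  these roads avoid each other contain it (`RoadSystem.eq_of_meet`). The roads of the levels between
  `q` and `2 q` are counted by their directions and spacings, so that all in all `O((q + 1) 16 ^ q)`
  roads matter (`RoadSystem.exists_finset_meet`).
* Each of these blocks the lattice points of a strip whose width is of order `2 ^ (9 q)`. A road can
  be shifted by up to half the spacing, and for the best of these shifts only `O(s)` of its points
  are blocked, by averaging (`RoadSystem.ncard_blocked_le`). The exponents leave a factor `2 ^ q`,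
  which absorbs the factor `q + 1`.

Between two points of a cell one moves away from the boundary of the cell by `O(s)`, takes a road in
the direction that is nearest to the right one, which misses the goal by `O(D / 4 ^ q) = O(s)`, and
pays a constant for each blocked point: the loss is `O(s)` (`RoadSystem.reach_cell`). Two vertices
at distance about `D` are joined by a segment that runs through at most three cells
(`RoadSystem.reach_of_le_side`).
-/

namespace SquishyGrid

/-! ### Rotated coordinates -/

/-- The coordinate of `(x, y)` along the direction of angle `α`. -/
noncomputable def along (α x y : ℝ) : ℝ := x * Real.cos α + y * Real.sin α

/-- The coordinate of `(x, y)` perpendicular to the direction of angle `α`. -/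
noncomputable def across (α x y : ℝ) : ℝ := y * Real.cos α - x * Real.sin α

theorem along_sq_add_across_sq (α x y : ℝ) :
    along α x y ^ 2 + across α x y ^ 2 = x ^ 2 + y ^ 2 := by
  unfold along across
  linear_combination (x ^ 2 + y ^ 2) * Real.sin_sq_add_cos_sq α

theorem along_sub (α x y x' y' : ℝ) :
    along α (x - x') (y - y') = along α x y - along α x' y' := by
  unfold along; ring

theorem across_sub (α x y x' y' : ℝ) :
    across α (x - x') (y - y') = across α x y - across α x' y' := by
  unfold across; ring

theorem abs_along_le (α x y : ℝ) :
    |along α x y| ≤ |x| * |Real.cos α| + |y| * |Real.sin α| := by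
  unfold along
  exact (abs_add_le _ _).trans (by rw [abs_mul, abs_mul])

theorem abs_across_le (α x y : ℝ) : |across α x y| ≤ |x| + |y| := by
  unfold across
  refine (abs_sub _ _).trans ?_
  rw [abs_mul, abs_mul]
  nlinarith [Real.abs_cos_le_one α, Real.abs_sin_le_one α, abs_nonneg x, abs_nonneg y]

theorem one_le_abs_cos_add_abs_sin (α : ℝ) : 1 ≤ |Real.cos α| + |Real.sin α| := by
  nlinarith [Real.sin_sq_add_cos_sq α, sq_abs (Real.cos α), sq_abs (Real.sin α),
    abs_nonneg (Real.cos α), abs_nonneg (Real.sin α)]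

theorem abs_cos_add_abs_sin_le (α : ℝ) : |Real.cos α| + |Real.sin α| ≤ √2 := by
  apply Real.le_sqrt_of_sq_le
  nlinarith [Real.sin_sq_add_cos_sq α, sq_abs (Real.cos α), sq_abs (Real.sin α),
    sq_nonneg (|Real.cos α| - |Real.sin α|)]

/-! ### Weights obtained by projecting vertices to lines -/

/-- A lattice point as a complex number. -/
def pt (v : ℤ × ℤ) : ℂ := ⟨v.1, v.2⟩

theorem norm_sub_eq_of_re_im {z : ℂ} {a : ℝ} (ha : 0 ≤ a) (h : z.re ^ 2 + z.im ^ 2 = a ^ 2) :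
    ‖z‖ = a := by
  rw [Complex.norm_eq_sqrt_sq_add_sq, h, Real.sqrt_sq ha]

/-- The data of a system of lines: each lattice point is owned by at most one line, and the line
`S` has direction angle `ang S` and offset `off S`, that is, the equation
`across (ang S) x y = off S`. The points owned by a line are within `√2 / 2` of it. -/
structure LineSystem (ι : Type*) where
  own : ℤ × ℤ → Option ι
  ang : ι → ℝ
  off : ι → ℝ
  near : ∀ v S, own v = some S → |across (ang S) v.1 v.2 - off S| ≤ √2 / 2

namespace LineSystem

variable {ι : Type*} (Λ : LineSystem ι)

/-- The orthogonal projection of a lattice point to the line owning it, and the point itself if it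
is not owned. -/
noncomputable def foot (v : ℤ × ℤ) : ℂ :=
  match Λ.own v with
  | none => pt v
  | some S => ⟨along (Λ.ang S) v.1 v.2 * Real.cos (Λ.ang S) - Λ.off S * Real.sin (Λ.ang S),
      along (Λ.ang S) v.1 v.2 * Real.sin (Λ.ang S) + Λ.off S * Real.cos (Λ.ang S)⟩

theorem foot_of_own {v : ℤ × ℤ} {S : ι} (h : Λ.own v = some S) :
    Λ.foot v = ⟨along (Λ.ang S) v.1 v.2 * Real.cos (Λ.ang S) - Λ.off S * Real.sin (Λ.ang S),
      along (Λ.ang S) v.1 v.2 * Real.sin (Λ.ang S) + Λ.off S * Real.cos (Λ.ang S)⟩ := by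
  simp [foot, h]

theorem norm_foot_sub_foot {u v : ℤ × ℤ} {S : ι} (hu : Λ.own u = some S) (hv : Λ.own v = some S) :
    ‖Λ.foot u - Λ.foot v‖ = |along (Λ.ang S) u.1 u.2 - along (Λ.ang S) v.1 v.2| := by
  rw [Λ.foot_of_own hu, Λ.foot_of_own hv]
  refine norm_sub_eq_of_re_im (abs_nonneg _) ?_
  rw [sq_abs]
  simp only [Complex.sub_re, Complex.sub_im]
  linear_combination (along (Λ.ang S) u.1 u.2 - along (Λ.ang S) v.1 v.2) ^ 2 *
    Real.sin_sq_add_cos_sq (Λ.ang S)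

theorem norm_foot_sub_pt (v : ℤ × ℤ) : ‖Λ.foot v - pt v‖ ≤ √2 / 2 := by
  rcases h : Λ.own v with _ | S
  · have : Λ.foot v = pt v := by simp [foot, h]
    rw [this, sub_self, norm_zero]; positivity
  · have h1 := Λ.near v S h
    rw [Λ.foot_of_own h]
    refine le_trans (le_of_eq (norm_sub_eq_of_re_im (abs_nonneg _) ?_)) h1
    rw [sq_abs]
    simp only [Complex.sub_re, Complex.sub_im, pt, along, across]
    generalize Λ.off S = c
    generalize (v.1 : ℝ) = x
    generalize (v.2 : ℝ) = y
    have h2 := Real.sin_sq_add_cos_sq (Λ.ang S)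
    generalize Real.sin (Λ.ang S) = s at *
    generalize Real.cos (Λ.ang S) = k at *
    have e1 : (x * k + y * s) * k - c * s - x = (y * k - x * s - c) * s := by
      linear_combination x * h2
    have e2 : (x * k + y * s) * s + c * k - y = -(y * k - x * s - c) * k := by
      linear_combination y * h2
    rw [e1, e2]
    linear_combination (y * k - x * s - c) ^ 2 * h2

open Classical in
/-- The cost of an edge: within a line the distance of the projections, and `4` otherwise. -/
noncomputable def cost (u v : ℤ × ℤ) : ℝ≥0 :=
  if Λ.own u = Λ.own v ∧ Λ.own u ≠ none then ‖Λ.foot u - Λ.foot v‖₊ else 4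

theorem cost_comm (u v : ℤ × ℤ) : Λ.cost u v = Λ.cost v u := by
  unfold cost
  by_cases h : Λ.own u = Λ.own v
  · simp only [h, true_and, ← NNReal.coe_inj]
    split_ifs
    · simp [norm_sub_rev]
    · rfl
  · simp [h, Ne.symm h]

theorem cost_of_own {u v : ℤ × ℤ} {S : ι} (hu : Λ.own u = some S) (hv : Λ.own v = some S) :
    (Λ.cost u v : ℝ) = |along (Λ.ang S) u.1 u.2 - along (Λ.ang S) v.1 v.2| := by
  rw [← Λ.norm_foot_sub_foot hu hv]
  simp [cost, hu, hv]

/-- Two lattice points are adjacent if they agree in one coordinate and differ by one in the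
other. -/
def Near (u v : ℤ × ℤ) : Prop :=
  (|u.1 - v.1| = 1 ∧ u.2 = v.2) ∨ (u.1 = v.1 ∧ |u.2 - v.2| = 1)

theorem norm_pt_sub_pt_of_near {u v : ℤ × ℤ} (h : Near u v) : ‖pt u - pt v‖ = 1 := by
  refine norm_sub_eq_of_re_im zero_le_one ?_
  have aux : ∀ a b : ℤ, |a - b| = 1 → ((a : ℝ) - b) ^ 2 = 1 := fun a b h => by
    rw [← sq_abs]
    have : |(a : ℝ) - b| = 1 := by exact_mod_cast h
    rw [this]; norm_num
  rcases h with ⟨h1, h2⟩ | ⟨h1, h2⟩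
  · simp [pt, h2, aux _ _ h1]
  · simp [pt, h1, aux _ _ h2]

theorem cost_of_near {u v : ℤ × ℤ} {S : ι} (h : Near u v) (hu : Λ.own u = some S)
    (hv : Λ.own v = some S) :
    (Λ.cost u v : ℝ) = |(u.1 : ℝ) - v.1| * |Real.cos (Λ.ang S)| +
      |(u.2 : ℝ) - v.2| * |Real.sin (Λ.ang S)| := by
  rw [Λ.cost_of_own hu hv, ← along_sub]
  unfold along
  rcases h with ⟨h1, h2⟩ | ⟨h1, h2⟩
  · simp [h2, abs_mul]
  · simp [h1, abs_mul]

theorem cost_le {u v : ℤ × ℤ} (h : Near u v) : (Λ.cost u v : ℝ) ≤ 4 := by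
  by_cases h1 : Λ.own u = Λ.own v ∧ Λ.own u ≠ none
  · obtain ⟨S, hS⟩ := Option.ne_none_iff_exists'.mp h1.2
    rw [Λ.cost_of_own hS (h1.1 ▸ hS), ← along_sub]
    refine le_trans (Real.abs_le_sqrt
      (le_of_le_of_eq (le_add_of_nonneg_right (sq_nonneg _)) (along_sq_add_across_sq _ _ _))) ?_
    have := norm_pt_sub_pt_of_near h
    rw [Complex.norm_eq_sqrt_sq_add_sq] at this
    simp only [pt, Complex.sub_re, Complex.sub_im] at this
    linarith
  · simp [cost, h1]

theorem sqrt_two_lt : √2 < 3 / 2 := by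
  rw [Real.sqrt_lt' (by norm_num)]; norm_num

/-- Outside the lines an edge costs at least one more than the distance of the projections of its
ends. -/
theorem norm_foot_add_one_le_cost {u v : ℤ × ℤ} (h : Near u v)
    (h1 : ¬ (Λ.own u = Λ.own v ∧ Λ.own u ≠ none)) :
    ‖Λ.foot u - Λ.foot v‖ + 1 ≤ Λ.cost u v := by
  have e : Λ.cost u v = 4 := by simp [cost, h1]
  rw [e]
  have h2 := norm_pt_sub_pt_of_near h
  have h3 := Λ.norm_foot_sub_pt u
  have h4 := Λ.norm_foot_sub_pt v
  have h5 : Λ.foot u - Λ.foot v = (Λ.foot u - pt u) + (pt u - pt v) - (Λ.foot v - pt v) := by ring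
  have h6 := (norm_sub_le (Λ.foot u - pt u + (pt u - pt v)) (Λ.foot v - pt v))
  have h7 := norm_add_le (Λ.foot u - pt u) (pt u - pt v)
  rw [h5]
  have := sqrt_two_lt
  push_cast
  linarith

/-- A grid vertex as a lattice point. -/
def lat {n : ℕ} (u : Fin n × Fin n) : ℤ × ℤ := (((u.1 : ℕ) : ℤ), ((u.2 : ℕ) : ℤ))

theorem norm_pos_sub_pos {n : ℕ} (u v : Fin n × Fin n) :
    ‖pos u - pos v‖ = ‖pt (lat u) - pt (lat v)‖ := by
  rw [EuclideanSpace.norm_eq, Complex.norm_eq_sqrt_sq_add_sq]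
  simp [pos, pt, lat, Fin.sum_univ_two]

theorem near_of_adj {n : ℕ} {u v : Fin n × Fin n} (h : (grid n).Adj u v) :
    Near (lat u) (lat v) := by
  simp only [grid, SimpleGraph.boxProd_adj, SimpleGraph.pathGraph_adj] at h
  unfold Near lat
  simp only
  rcases h with ⟨h1, h2⟩ | ⟨h1, h2⟩
  · left; refine ⟨?_, by rw [h2]⟩
    rcases h1 with h1 | h1
    · rw [abs_eq zero_le_one]; right; omega
    · rw [abs_eq zero_le_one]; left; omega
  · right; refine ⟨by rw [h2], ?_⟩
    rcases h1 with h1 | h1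
    · rw [abs_eq zero_le_one]; right; omega
    · rw [abs_eq zero_le_one]; left; omega

theorem adj_of_near {n : ℕ} {u v : Fin n × Fin n} (h : Near (lat u) (lat v)) :
    (grid n).Adj u v := by
  simp only [grid, SimpleGraph.boxProd_adj, SimpleGraph.pathGraph_adj]
  unfold Near lat at h
  simp only [Fin.ext_iff] at h ⊢
  rcases h with ⟨h1, h2⟩ | ⟨h1, h2⟩
  · rw [abs_eq zero_le_one] at h1; omega
  · rw [abs_eq zero_le_one] at h2; omega

/-- The edge weights of the `n × n` grid given by a line system. -/
noncomputable def weight (n : ℕ) : Sym2 (Fin n × Fin n) → ℝ≥0 :=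
  Sym2.lift ⟨fun u v => Λ.cost (lat u) (lat v), fun u v => Λ.cost_comm (lat u) (lat v)⟩

theorem walkWeight_cons {n : ℕ} {u v w : Fin n × Fin n} (h : (grid n).Adj u v)
    (p : (grid n).Walk v w) :
    (walkWeight (Λ.weight n) (SimpleGraph.Walk.cons h p) : ℝ) =
      Λ.cost (lat u) (lat v) + walkWeight (Λ.weight n) p := by
  simp [walkWeight, weight]

/-- A walk either stays in one line, where each step pays for its part of the displacement, or it
pays at least one more than the distance of the projections of its ends. -/
theorem walk_dichotomy {n : ℕ} {u v : Fin n × Fin n} (p : (grid n).Walk u v) :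
    u = v ∨
    (∃ S, Λ.own (lat u) = some S ∧ Λ.own (lat v) = some S ∧
      |((lat u).1 : ℝ) - (lat v).1| * |Real.cos (Λ.ang S)| +
        |((lat u).2 : ℝ) - (lat v).2| * |Real.sin (Λ.ang S)| ≤ walkWeight (Λ.weight n) p) ∨
    ‖Λ.foot (lat u) - Λ.foot (lat v)‖ + 1 ≤ walkWeight (Λ.weight n) p := by
  induction p with
  | nil => exact Or.inl rfl
  | @cons u v w h p ih =>
    right
    rw [Λ.walkWeight_cons h p]
    have hn := near_of_adj h
    have htri : ‖Λ.foot (lat u) - Λ.foot (lat w)‖ ≤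
        ‖Λ.foot (lat u) - Λ.foot (lat v)‖ + ‖Λ.foot (lat v) - Λ.foot (lat w)‖ :=
      norm_sub_le_norm_sub_add_norm_sub _ _ _
    have hp : (0 : ℝ) ≤ walkWeight (Λ.weight n) p := NNReal.coe_nonneg _
    by_cases h1 : Λ.own (lat u) = Λ.own (lat v) ∧ Λ.own (lat u) ≠ none
    · obtain ⟨S, hS⟩ := Option.ne_none_iff_exists'.mp h1.2
      have hv : Λ.own (lat v) = some S := h1.1 ▸ hS
      have hc := Λ.cost_of_near hn hS hv
      rcases ih with rfl | ⟨S', hv', hw', ih⟩ | ih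
      · left; exact ⟨S, hS, hv, by linarith⟩
      · left
        obtain rfl : S = S' := by simpa [hv] using hv'
        refine ⟨S, hS, hw', ?_⟩
        have a1 := abs_sub_le ((lat u).1 : ℝ) (lat v).1 (lat w).1
        have a2 := abs_sub_le ((lat u).2 : ℝ) (lat v).2 (lat w).2
        have b1 := mul_le_mul_of_nonneg_right a1 (abs_nonneg (Real.cos (Λ.ang S)))
        have b2 := mul_le_mul_of_nonneg_right a2 (abs_nonneg (Real.sin (Λ.ang S)))
        linarith
      · right
        rw [Λ.cost_of_own hS hv, ← Λ.norm_foot_sub_foot hS hv]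
        linarith
    · right
      have hc := Λ.norm_foot_add_one_le_cost hn h1
      have : ‖Λ.foot (lat v) - Λ.foot (lat w)‖ ≤ walkWeight (Λ.weight n) p := by
        rcases ih with rfl | ⟨S', hv', hw', ih⟩ | ih
        · simp
        · refine le_trans ?_ ih
          rw [Λ.norm_foot_sub_foot hv' hw', ← along_sub]
          exact abs_along_le _ _ _
        · linarith
      linarith

theorem int_sq_le_one {b : ℤ} (h : b ^ 2 ≤ 2) : b ^ 2 ≤ 1 := by
  have h1 : b ≤ 1 := by nlinarith
  have h2 : -1 ≤ b := by nlinarith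
  nlinarith

/-- Two lattice points of one strip of width `√2` are at distance at most one more than the weight
of any walk joining them in the strip. -/
theorem sqrt_le_add_one {a b : ℤ} {α X : ℝ} (hac : across α a b ^ 2 ≤ 2)
    (hX : |(a : ℝ)| * |Real.cos α| + |(b : ℝ)| * |Real.sin α| ≤ X) :
    √((a : ℝ) ^ 2 + (b : ℝ) ^ 2) ≤ X + 1 := by
  have h1 := along_sq_add_across_sq α a b
  have h2 := abs_along_le α a b
  have h3 : along α a b ^ 2 ≤ X ^ 2 := sq_le_sq' (by linarith [neg_abs_le (along α a b)])
    (by linarith [le_abs_self (along α a b)])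
  have hX0 : 0 ≤ X := le_trans (by positivity) hX
  by_cases hX1 : 1 / 2 ≤ X
  · exact Real.sqrt_le_iff.2 ⟨by linarith, by nlinarith⟩
  push Not at hX1
  have h4 : (a : ℝ) ^ 2 + (b : ℝ) ^ 2 < 3 := by nlinarith
  have h5 : a ^ 2 + b ^ 2 ≤ 2 := by
    have : a ^ 2 + b ^ 2 < 3 := by exact_mod_cast h4
    omega
  rcases eq_or_ne a 0 with rfl | ha
  · have hb : b ^ 2 ≤ 1 := int_sq_le_one (by linarith)
    have : (b : ℝ) ^ 2 ≤ 1 := by exact_mod_cast hb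
    exact Real.sqrt_le_iff.2 ⟨by linarith, by push_cast; nlinarith⟩
  rcases eq_or_ne b 0 with rfl | hb
  · have hb : a ^ 2 ≤ 1 := int_sq_le_one (by linarith)
    have : (a : ℝ) ^ 2 ≤ 1 := by exact_mod_cast hb
    exact Real.sqrt_le_iff.2 ⟨by linarith, by push_cast; nlinarith⟩
  have ha1 : (1 : ℝ) ≤ |(a : ℝ)| := by exact_mod_cast Int.one_le_abs ha
  have hb1 : (1 : ℝ) ≤ |(b : ℝ)| := by exact_mod_cast Int.one_le_abs hb
  have := one_le_abs_cos_add_abs_sin α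
  nlinarith [abs_nonneg (Real.cos α), abs_nonneg (Real.sin α)]

theorem norm_sub_one_le_wdist {n : ℕ} (u v : Fin n × Fin n) :
    ‖pos u - pos v‖ - 1 ≤ wdist (grid n) (Λ.weight n) u v := by
  have := nonempty_grid_walk u v
  refine le_ciInf fun p => ?_
  have hs := Real.sq_sqrt (show (0 : ℝ) ≤ 2 by norm_num)
  have hs' := sqrt_two_lt
  rw [norm_pos_sub_pos]
  rcases Λ.walk_dichotomy p with rfl | ⟨S, hu, hv, h⟩ | h
  · simp; linarith [NNReal.coe_nonneg (walkWeight (Λ.weight n) p)]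
  · have h1 := Λ.near _ _ hu
    have h2 := Λ.near _ _ hv
    have h3 : across (Λ.ang S) ((lat u).1 - (lat v).1 : ℤ) ((lat u).2 - (lat v).2 : ℤ) ^ 2 ≤ 2 := by
      push_cast
      rw [across_sub]
      rw [abs_le] at h1 h2
      rw [← hs]
      apply sq_le_sq'
      all_goals linarith [h1.1, h1.2, h2.1, h2.2]
    have h4 := sqrt_le_add_one (X := walkWeight (Λ.weight n) p) h3 (by push_cast; exact h)
    rw [Complex.norm_eq_sqrt_sq_add_sq]
    simp only [pt, Complex.sub_re, Complex.sub_im]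
    push_cast at h4
    linarith
  · have h3 := Λ.norm_foot_sub_pt (lat u)
    have h4 := Λ.norm_foot_sub_pt (lat v)
    have h5 : pt (lat u) - pt (lat v) = (Λ.foot (lat u) - Λ.foot (lat v)) -
      (Λ.foot (lat u) - pt (lat u)) + (Λ.foot (lat v) - pt (lat v)) := by ring
    have h6 := norm_add_le ((Λ.foot (lat u) - Λ.foot (lat v)) -
      (Λ.foot (lat u) - pt (lat u))) (Λ.foot (lat v) - pt (lat v))
    have h7 := norm_sub_le (Λ.foot (lat u) - Λ.foot (lat v)) (Λ.foot (lat u) - pt (lat u))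
    rw [h5]
    linarith

/-! ### Upper bounds for weighted distances -/

/-- There is a walk of weight at most `x` from `u` to `v`. -/
def Reach {n : ℕ} (u v : Fin n × Fin n) (x : ℝ) : Prop :=
  ∃ p : (grid n).Walk u v, (walkWeight (Λ.weight n) p : ℝ) ≤ x

variable {Λ}

theorem Reach.wdist_le {n : ℕ} {u v : Fin n × Fin n} {x : ℝ} (h : Λ.Reach u v x) :
    wdist (grid n) (Λ.weight n) u v ≤ x := by
  obtain ⟨p, hp⟩ := h
  exact (ciInf_le ⟨0, by rintro _ ⟨q, rfl⟩; exact NNReal.coe_nonneg _⟩ p).trans hp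

theorem Reach.mono {n : ℕ} {u v : Fin n × Fin n} {x y : ℝ} (h : Λ.Reach u v x) (hxy : x ≤ y) :
    Λ.Reach u v y :=
  h.imp fun _ hp => hp.trans hxy

theorem Reach.trans {n : ℕ} {u v w : Fin n × Fin n} {x y : ℝ} (h : Λ.Reach u v x)
    (h' : Λ.Reach v w y) : Λ.Reach u w (x + y) := by
  obtain ⟨p, hp⟩ := h
  obtain ⟨q, hq⟩ := h'
  refine ⟨p.append q, ?_⟩
  have : walkWeight (Λ.weight n) (p.append q) =
      walkWeight (Λ.weight n) p + walkWeight (Λ.weight n) q := by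
    simp [walkWeight, SimpleGraph.Walk.edges_append]
  rw [this]
  push_cast
  linarith

theorem Reach.refl {n : ℕ} (u : Fin n × Fin n) : Λ.Reach u u 0 :=
  ⟨SimpleGraph.Walk.nil, by simp [walkWeight]⟩

theorem Reach.of_near {n : ℕ} {u v : Fin n × Fin n} (h : Near (lat u) (lat v)) :
    Λ.Reach u v (Λ.cost (lat u) (lat v)) :=
  ⟨SimpleGraph.Walk.cons (adj_of_near h) SimpleGraph.Walk.nil, by
    rw [walkWeight_cons]; simp [walkWeight]⟩

/-- A lattice point with coordinates in `[0, n)`. -/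
def InGrid (n : ℕ) (v : ℤ × ℤ) : Prop := (0 ≤ v.1 ∧ v.1 < n) ∧ 0 ≤ v.2 ∧ v.2 < n

theorem inGrid_lat {n : ℕ} (u : Fin n × Fin n) : InGrid n (lat u) := by
  have h1 := u.1.2
  have h2 := u.2.2
  unfold InGrid lat
  simp only
  omega

theorem InGrid.exists_lat {n : ℕ} {v : ℤ × ℤ} (h : InGrid n v) :
    ∃ u : Fin n × Fin n, lat u = v := by
  obtain ⟨⟨h1, h2⟩, h3, h4⟩ := h
  refine ⟨(⟨v.1.toNat, by omega⟩, ⟨v.2.toNat, by omega⟩), ?_⟩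
  ext <;> simp [lat, h1, h3]

theorem lat_injective {n : ℕ} : Function.Injective (lat (n := n)) := by
  intro u v h
  simpa [lat, Prod.ext_iff, Fin.ext_iff] using h

/-- A sequence of adjacent lattice points in the grid is a walk. -/
theorem Reach.of_seq {n : ℕ} (g : ℕ → ℤ × ℤ) (N : ℕ) (hg : ∀ i ≤ N, InGrid n (g i))
    (hn : ∀ i < N, Near (g i) (g (i + 1))) {u v : Fin n × Fin n} (hu : lat u = g 0)
    (hv : lat v = g N) :
    Λ.Reach u v (∑ i ∈ Finset.range N, (Λ.cost (g i) (g (i + 1)) : ℝ)) := by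
  induction N generalizing v with
  | zero =>
    obtain rfl : u = v := lat_injective (hu.trans hv.symm)
    simpa using Reach.refl u
  | succ N ih =>
    obtain ⟨w, hw⟩ := (hg N (by omega)).exists_lat
    rw [Finset.sum_range_succ]
    refine (ih (fun i hi => hg i (by omega)) (fun i hi => hn i (by omega)) hw).trans ?_
    have := Reach.of_near (Λ := Λ) (u := w) (v := v) (by rw [hw, hv]; exact hn N (by omega))
    rwa [hw, hv] at this

/-- Moving along a row or a column, each edge costs at most `4`. -/
theorem reach_of_forall_near {n : ℕ} (f : Fin n → Fin n × Fin n)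
    (hf : ∀ c d : Fin n, |(c : ℤ) - (d : ℤ)| = 1 → Near (lat (f c)) (lat (f d))) (a a' : Fin n) :
    Λ.Reach (f a) (f a') (4 * |((a : ℕ) : ℝ) - (a' : ℕ)|) := by
  have key : ∀ k : ℕ, ∀ (c c' : Fin n), ((c : ℤ) - (c' : ℤ)).natAbs = k →
      Λ.Reach (f c) (f c') (4 * (k : ℝ)) := by
    intro k
    induction k with
    | zero =>
      intro c c' h
      obtain rfl : c = c' := by ext; omega
      simpa using Reach.refl _
    | succ k ih =>
      intro c c' h
      have hc := c.2
      have hc' := c'.2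
      obtain ⟨d, hd, hd'⟩ : ∃ d : Fin n, |(c : ℤ) - (d : ℤ)| = 1 ∧
          ((d : ℤ) - (c' : ℤ)).natAbs = k := by
        rcases lt_or_ge (c : ℕ) c' with h' | h'
        · refine ⟨⟨c + 1, by omega⟩, ?_, ?_⟩
          · rw [abs_eq zero_le_one]; right; push_cast; omega
          · push_cast; omega
        · refine ⟨⟨c - 1, by omega⟩, ?_, ?_⟩
          · rw [abs_eq zero_le_one]; left; simp only; omega
          · simp only; omega
      have hn := hf c d hd
      refine (((Reach.of_near hn).mono (Λ.cost_le hn)).trans (ih d c' hd')).mono ?_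
      push_cast; linarith
  refine (key _ a a' rfl).mono (le_of_eq ?_)
  rw [Nat.cast_natAbs]; push_cast; rfl

theorem reach_l1 {n : ℕ} (u v : Fin n × Fin n) :
    Λ.Reach u v (4 * (|((lat u).1 : ℝ) - (lat v).1| + |((lat u).2 : ℝ) - (lat v).2|)) := by
  refine ((reach_of_forall_near (fun c => (c, u.2)) (fun c d h => Or.inl ⟨h, rfl⟩) u.1 v.1).trans
    (reach_of_forall_near (fun c => (v.1, c)) (fun c d h => Or.inr ⟨rfl, h⟩) u.2 v.2)).mono
      (le_of_eq ?_)
  simp [lat]; ring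

end LineSystem

open LineSystem

/-! ### Digital lines -/

/-- One step of a digital line: a unit step in a coordinate direction that does not decrease the
coordinate along the line and keeps within the strip of half-width `√2 / 2`. -/
theorem exists_step {α c σ τ : ℝ} (hσ : σ * Real.cos α = |Real.cos α|) (hσ1 : σ = 1 ∨ σ = -1)
    (hτ : τ * Real.sin α = |Real.sin α|) (hτ1 : τ = 1 ∨ τ = -1) {x y : ℝ}
    (h : |across α x y - c| ≤ √2 / 2) :
    |across α (x + σ) y - c| ≤ √2 / 2 ∨ |across α x (y + τ) - c| ≤ √2 / 2 := by
  have h1 : across α (x + σ) y = across α x y - σ * Real.sin α := by unfold across; ring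
  have h2 : across α x (y + τ) = across α x y + τ * Real.cos α := by unfold across; ring
  have h3 := abs_cos_add_abs_sin_le α
  have h4 := abs_nonneg (Real.cos α)
  have h5 := abs_nonneg (Real.sin α)
  rw [h1, h2]
  rw [abs_le] at h
  simp only [abs_le]
  by_contra! hcon
  obtain ⟨c1, c2⟩ := hcon
  rcases hσ1 with rfl | rfl <;> rcases hτ1 with rfl | rfl
  all_goals
    by_cases e1 : -(√2 / 2) ≤ across α x y - c + |Real.cos α| <;>
    by_cases e2 : across α x y - c + |Real.cos α| ≤ √2 / 2
  all_goals
    first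
    | linarith [c1 (by linarith), c2 (by linarith)]
    | grind

theorem exists_sign (a : ℝ) : ∃ σ : ℤ, (σ = 1 ∨ σ = -1) ∧ (σ : ℝ) * a = |a| := by
  rcases le_total 0 a with h | h
  · exact ⟨1, Or.inl rfl, by simp [abs_of_nonneg h]⟩
  · exact ⟨-1, Or.inr rfl, by simp [abs_of_nonpos h]⟩

/-- From every lattice point of a strip of half-width `√2 / 2` starts an infinite lattice walk in
the strip that is monotone along the strip, visits no point twice and is unbounded. The half-width
`√2 / 2`, the maximum of `(|cos α| + |sin α|) / 2`, leaves room for a step in one of the two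
coordinate directions everywhere. -/
theorem exists_digital_line (α c : ℝ) (v : ℤ × ℤ) (hv : |across α v.1 v.2 - c| ≤ √2 / 2) :
    ∃ g : ℕ → ℤ × ℤ, g 0 = v ∧ (∀ i, |across α (g i).1 (g i).2 - c| ≤ √2 / 2) ∧
      (∀ i, Near (g i) (g (i + 1))) ∧ Function.Injective g ∧
      (∀ i, along α (g i).1 (g i).2 ≤ along α (g (i + 1)).1 (g (i + 1)).2) ∧
      (∀ i, along α (g (i + 1)).1 (g (i + 1)).2 ≤ along α (g i).1 (g i).2 + 1) ∧
      ∀ b : ℝ, ∃ i, b ≤ along α (g i).1 (g i).2 := by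
  obtain ⟨σ, hσ1, hσ⟩ := exists_sign (Real.cos α)
  obtain ⟨τ, hτ1, hτ⟩ := exists_sign (Real.sin α)
  have hstep : ∀ w : {w : ℤ × ℤ // |across α w.1 w.2 - c| ≤ √2 / 2},
      ∃ w' : {w : ℤ × ℤ // |across α w.1 w.2 - c| ≤ √2 / 2},
        w'.1 = (w.1.1 + σ, w.1.2) ∨ w'.1 = (w.1.1, w.1.2 + τ) := by
    rintro ⟨⟨x, y⟩, hw⟩
    rcases exists_step hσ (by exact_mod_cast hσ1) hτ (by exact_mod_cast hτ1) hw with h | h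
    · exact ⟨⟨(x + σ, y), by push_cast; exact h⟩, Or.inl rfl⟩
    · exact ⟨⟨(x, y + τ), by push_cast; exact h⟩, Or.inr rfl⟩
  choose s hs using hstep
  let g' : ℕ → {w : ℤ × ℤ // |across α w.1 w.2 - c| ≤ √2 / 2} := fun i => s^[i] ⟨v, hv⟩
  have hg : ∀ i, (g' (i + 1)).1 = ((g' i).1.1 + σ, (g' i).1.2) ∨
      (g' (i + 1)).1 = ((g' i).1.1, (g' i).1.2 + τ) := by
    intro i
    simp only [g', Function.iterate_succ_apply']
    exact hs _
  have hσσ : σ * σ = 1 := by rcases hσ1 with rfl | rfl <;> norm_num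
  have hττ : τ * τ = 1 := by rcases hτ1 with rfl | rfl <;> norm_num
  -- each step increases `σ x + τ y` by one
  have hsum : ∀ i : ℕ, σ * (g' i).1.1 + τ * (g' i).1.2 = σ * v.1 + τ * v.2 + i := by
    intro i
    induction i with
    | zero => simp [g']
    | succ i ih =>
      rcases hg i with h | h <;> rw [h] <;> push_cast <;> linarith
  have hσa : |(σ : ℤ)| = 1 := by rcases hσ1 with rfl | rfl <;> norm_num
  have hτa : |(τ : ℤ)| = 1 := by rcases hτ1 with rfl | rfl <;> norm_num
  have halong : ∀ i, ∃ δ : ℝ, 0 ≤ δ ∧ δ ≤ 1 ∧ along α (g' (i + 1)).1.1 (g' (i + 1)).1.2 =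
      along α (g' i).1.1 (g' i).1.2 + δ := by
    intro i
    rcases hg i with h | h <;> rw [h]
    · exact ⟨|Real.cos α|, abs_nonneg _, Real.abs_cos_le_one α, by
        unfold along; push_cast; rw [← hσ]; ring⟩
    · exact ⟨|Real.sin α|, abs_nonneg _, Real.abs_sin_le_one α, by
        unfold along; push_cast; rw [← hτ]; ring⟩
  have hmono : ∀ i, along α v.1 v.2 ≤ along α (g' i).1.1 (g' i).1.2 := by
    intro i
    induction i with
    | zero => exact le_rfl
    | succ i ih => obtain ⟨δ, h0, -, h⟩ := halong i; linarith
  refine ⟨fun i => (g' i).1, rfl, fun i => (g' i).2, fun i => ?_, fun i j hij => ?_, fun i => ?_,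
    fun i => ?_, fun b => ?_⟩
  · rcases hg i with h | h <;> simp only [h, Near]
    · left; simp [hσa]
    · right; simp [hτa]
  · have h1 := hsum i
    have h2 := hsum j
    simp only at hij
    rw [hij, h2] at h1
    exact_mod_cast (by linarith : (i : ℤ) = j)
  · obtain ⟨δ, h0, -, h⟩ := halong i
    simp only; linarith
  · obtain ⟨δ, -, h1, h⟩ := halong i
    simp only; linarith
  · -- the displacement has large norm and is bounded across the strip
    obtain ⟨i, hi⟩ := exists_nat_gt (2 * (|b - along α v.1 v.2| + 2))
    refine ⟨i, ?_⟩
    by_contra! hlt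
    have h1 : (σ : ℝ) * ((g' i).1.1 - v.1) + τ * ((g' i).1.2 - v.2) = i := by
      have := hsum i
      have h' : ((σ * (g' i).1.1 + τ * (g' i).1.2 : ℤ) : ℝ) = (σ * v.1 + τ * v.2 + i : ℤ) := by
        exact_mod_cast this
      push_cast at h'
      linarith
    have h2 := along_sq_add_across_sq α ((g' i).1.1 - v.1) ((g' i).1.2 - v.2)
    rw [along_sub, across_sub] at h2
    have h3 := (g' i).2
    have h4 := hmono i
    have hσσ' : (σ : ℝ) * σ = 1 := by exact_mod_cast hσσ
    have hττ' : (τ : ℝ) * τ = 1 := by exact_mod_cast hττ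
    set X : ℝ := (g' i).1.1 - v.1
    set Y : ℝ := (g' i).1.2 - v.2
    set t := along α (g' i).1.1 (g' i).1.2 - along α v.1 v.2
    have ht : |t| ≤ |b - along α v.1 v.2| := by
      rw [abs_of_nonneg (by simp only [t]; linarith)]
      exact le_trans (by simp only [t]; linarith) (le_abs_self _)
    have ht2 : t ^ 2 ≤ |b - along α v.1 v.2| ^ 2 := by
      rw [← sq_abs t]; exact pow_le_pow_left₀ (abs_nonneg _) ht 2
    have hf : (across α (g' i).1.1 (g' i).1.2 - across α v.1 v.2) ^ 2 ≤ 2 := by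
      refine le_of_le_of_eq ?_ (Real.sq_sqrt (show (0 : ℝ) ≤ 2 by norm_num))
      rw [abs_le] at h3 hv
      apply sq_le_sq' <;> linarith [h3.1, h3.2, hv.1, hv.2]
    have h5 : (i : ℝ) ^ 2 ≤ 2 * (X ^ 2 + Y ^ 2) := by
      rw [← h1]
      nlinarith [sq_nonneg (σ * X - τ * Y), mul_self_nonneg X]
    nlinarith [abs_nonneg (b - along α v.1 v.2)]

/-! ### Counting lattice points -/

theorem card_int_Icc_le {a b : ℝ} (h : a ≤ b + 1) :
    ((Finset.Icc ⌈a⌉ ⌊b⌋).card : ℝ) ≤ b - a + 1 := by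
  rw [Int.card_Icc]
  have h1 := Int.le_ceil a
  have h2 := Int.floor_le b
  rcases le_total (⌊b⌋ + 1 - ⌈a⌉) 0 with h3 | h3
  · rw [Int.toNat_of_nonpos h3]; push_cast; linarith
  · have : (((⌊b⌋ + 1 - ⌈a⌉).toNat : ℤ) : ℝ) = ((⌊b⌋ + 1 - ⌈a⌉ : ℤ) : ℝ) := by
      rw [Int.toNat_of_nonneg h3]
    push_cast at this
    linarith

theorem exists_cover_of_coeff {A B c x₀ D h : ℝ} (hA : 2 / 3 ≤ |A|) (hD : 0 ≤ D) (hh : 0 ≤ h) :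
    ∃ F : Finset (ℤ × ℤ), (F.card : ℝ) ≤ (D + 1) * (3 * h + 1) ∧
      ∀ v : ℤ × ℤ, x₀ ≤ v.1 → (v.1 : ℝ) ≤ x₀ + D → |(v.2 : ℝ) * A - v.1 * B - c| ≤ h → v ∈ F := by
  have hA0 : A ≠ 0 := by rintro rfl; simp at hA; norm_num at hA
  have hA' : 0 < |A| := abs_pos.2 hA0
  refine ⟨(Finset.Icc ⌈x₀⌉ ⌊x₀ + D⌋).biUnion fun x =>
    (Finset.Icc ⌈((x : ℝ) * B + c) / A - 3 / 2 * h⌉ ⌊((x : ℝ) * B + c) / A + 3 / 2 * h⌋).image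
      fun y => (x, y), ?_, ?_⟩
  · have h1 := Finset.card_biUnion_le_card_mul (Finset.Icc ⌈x₀⌉ ⌊x₀ + D⌋)
      (fun x => (Finset.Icc ⌈((x : ℝ) * B + c) / A - 3 / 2 * h⌉
        ⌊((x : ℝ) * B + c) / A + 3 / 2 * h⌋).image fun y => (x, y)) ⌊3 * h + 1⌋₊ ?_
    · have h2 : ((Finset.Icc ⌈x₀⌉ ⌊x₀ + D⌋).card : ℝ) ≤ D + 1 :=
        (card_int_Icc_le (by linarith)).trans (by linarith)
      refine (Nat.cast_le.2 h1).trans ?_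
      push_cast
      exact mul_le_mul h2 (Nat.floor_le (by linarith)) (by positivity) (by linarith)
    · intro x _
      refine Finset.card_image_le.trans (Nat.le_floor ?_)
      exact (card_int_Icc_le (by linarith)).trans (by linarith)
  · rintro ⟨x, y⟩ h1 h2 h3
    simp only at h1 h2 h3
    simp only [Finset.mem_biUnion, Finset.mem_Icc, Finset.mem_image, Prod.mk.injEq]
    refine ⟨x, ⟨Int.ceil_le.2 h1, Int.le_floor.2 h2⟩, y, ?_, rfl, rfl⟩
    have h4 : |(y : ℝ) - (x * B + c) / A| ≤ 3 / 2 * h := by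
      have e : (y : ℝ) * A - x * B - c = (y - (x * B + c) / A) * A := by field_simp; ring
      rw [e, abs_mul] at h3
      nlinarith [abs_nonneg ((y : ℝ) - (x * B + c) / A)]
    rw [abs_le] at h4
    exact ⟨Int.ceil_le.2 (by linarith [h4.1]), Int.le_floor.2 (by linarith [h4.2])⟩

/-- A strip of half-width `h` contains `O((D + 1) (h + 1))` lattice points of a square of side
`D`. -/
theorem exists_strip_cover (α c x₀ y₀ : ℝ) {D h : ℝ} (hD : 0 ≤ D) (hh : 0 ≤ h) :
    ∃ F : Finset (ℤ × ℤ), (F.card : ℝ) ≤ (D + 1) * (3 * h + 1) ∧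
      ∀ v : ℤ × ℤ, x₀ ≤ v.1 → (v.1 : ℝ) ≤ x₀ + D → y₀ ≤ v.2 → (v.2 : ℝ) ≤ y₀ + D →
        |across α v.1 v.2 - c| ≤ h → v ∈ F := by
  by_cases hc : 2 / 3 ≤ |Real.cos α|
  · obtain ⟨F, hF, hF'⟩ := exists_cover_of_coeff (B := Real.sin α) (c := c) (x₀ := x₀) hc hD hh
    exact ⟨F, hF, fun v h1 h2 _ _ h5 => hF' v h1 h2 h5⟩
  · have hs : 2 / 3 ≤ |-Real.sin α| := by
      rw [abs_neg]
      push Not at hc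
      nlinarith [Real.sin_sq_add_cos_sq α, sq_abs (Real.cos α), sq_abs (Real.sin α),
        abs_nonneg (Real.cos α), abs_nonneg (Real.sin α)]
    obtain ⟨F, hF, hF'⟩ :=
      exists_cover_of_coeff (B := -Real.cos α) (c := c) (x₀ := y₀) hs hD hh
    refine ⟨F.image Prod.swap, (Nat.cast_le.2 Finset.card_image_le).trans hF,
      fun v _ _ h3 h4 h5 => Finset.mem_image.2 ⟨v.swap, hF' v.swap h3 h4 ?_, Prod.swap_swap v⟩⟩
    simp only [Prod.fst_swap, Prod.snd_swap]
    convert h5 using 2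
    unfold across; ring

/-! ### The system of roads -/

/-- The side length of the cells of level `q`. -/
noncomputable def side (θ : ℝ) (q : ℕ) : ℝ := θ * 2 ^ (18 * q)

/-- The spacing of parallel roads of level `q`. -/
noncomputable def gap (θ : ℝ) (q : ℕ) : ℝ := θ * 2 ^ (16 * q)

/-- The index of the cell of level `q` containing a lattice point. -/
noncomputable def cellOf (θ : ℝ) (q : ℕ) (v : ℤ × ℤ) : ℤ × ℤ :=
  (⌊(v.1 : ℝ) / side θ q⌋, ⌊(v.2 : ℝ) / side θ q⌋)

/-- The name of a road: its level, the cell of that level that it crosses, the number of its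
direction (one of `4 ^ level`) and its number among the parallel roads. -/
@[ext] structure Road where
  level : ℕ
  cell : ℤ × ℤ
  dir : ℕ
  row : ℤ

namespace Road

/-- The direction of a road. -/
noncomputable def angle (S : Road) : ℝ := 2 * Real.pi * S.dir / 4 ^ S.level

/-- The `l`-th of the possible offsets of a road. -/
noncomputable def offset (θ : ℝ) (S : Road) (l : ℕ) : ℝ := S.row * gap θ S.level + 2 * l

/-- The lattice points of the cell of `S` that are near the line with the `l`-th offset. Only roads
of level at most `Q` and with a direction number less than `4 ^ level` exist. -/
def strip (θ : ℝ) (Q : ℕ) (S : Road) (l : ℕ) : Set (ℤ × ℤ) :=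
  {v | S.level ≤ Q ∧ S.dir < 4 ^ S.level ∧ cellOf θ S.level v = S.cell ∧
    |across S.angle v.1 v.2 - S.offset θ l| ≤ √2 / 2}

/-- An arbitrary numbering of the roads. -/
def code (S : Road) : ℕ := Encodable.encode (S.level, S.cell, S.dir, S.row)

theorem code_injective : Function.Injective code := by
  intro S T h
  have := Encodable.encode_injective h
  simp only [Prod.mk.injEq] at this
  obtain ⟨h1, h2, h3, h4⟩ := this
  exact Road.ext h1 h2 h3 h4

/-- The order in which roads are placed: from the highest level to the lowest. -/
def Before (Q : ℕ) (T S : Road) : Prop :=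
  toLex (Q - T.level, T.code) < toLex (Q - S.level, S.code)

theorem before_wf (Q : ℕ) : WellFounded (Before Q) :=
  InvImage.wf (fun S : Road => toLex (Q - S.level, S.code)) wellFounded_lt

theorem before_or_before (Q : ℕ) {S T : Road} (h : S ≠ T) : Before Q S T ∨ Before Q T S := by
  apply lt_or_gt_of_ne
  intro h'
  apply h
  apply code_injective
  have := congrArg (fun x => (ofLex x).2) h'
  simpa using this

theorem Before.level_le {Q : ℕ} {T S : Road} (h : Before Q T S) (hT : T.level ≤ Q)
    (hS : S.level ≤ Q) : S.level ≤ T.level := by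
  rcases Prod.Lex.lt_iff.1 h with h | h
  · simp at h; omega
  · simp at h; omega

/-- A lattice point is blocked for `S` if its cell of level `S.level / 2` meets a road placed
before `S`; here `A T` is the set of lattice points of the road `T`. -/
def Blocked (θ : ℝ) (Q : ℕ) (A : Road → Set (ℤ × ℤ)) (S : Road) (v : ℤ × ℤ) : Prop :=
  ∃ T, Before Q T S ∧ ∃ w ∈ A T, cellOf θ (S.level / 2) w = cellOf θ (S.level / 2) v

end Road

open Road

/-- A choice of offsets `l` and point sets `A` for all roads: a road consists of the points of its
strip that are not blocked, and its offset, within a range of half the spacing, minimizes the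
number of blocked points. -/
structure RoadSystem (θ : ℝ) (Q : ℕ) where
  A : Road → Set (ℤ × ℤ)
  l : Road → ℕ
  l_le : ∀ S, l S ≤ ⌊gap θ S.level / 2⌋₊
  mem_A : ∀ S v, v ∈ A S ↔ v ∈ S.strip θ Q (l S) ∧ ¬ Blocked θ Q A S v
  minimal : ∀ S, ∀ l' ≤ ⌊gap θ S.level / 2⌋₊,
    {v | v ∈ S.strip θ Q (l S) ∧ Blocked θ Q A S v}.ncard ≤
      {v | v ∈ S.strip θ Q l' ∧ Blocked θ Q A S v}.ncard

theorem exists_roadSystem (θ : ℝ) (Q : ℕ) : Nonempty (RoadSystem θ Q) := by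
  -- blocked points in terms of the roads placed before
  let B : (S : Road) → ((T : Road) → Before Q T S → ℕ × Set (ℤ × ℤ)) → Set (ℤ × ℤ) := fun S f =>
    {v | ∃ T, ∃ h : Before Q T S, ∃ w ∈ (f T h).2,
      cellOf θ (S.level / 2) w = cellOf θ (S.level / 2) v}
  have hex : ∀ (S : Road) (f : (T : Road) → Before Q T S → ℕ × Set (ℤ × ℤ)),
      ∃ l ≤ ⌊gap θ S.level / 2⌋₊, ∀ l' ≤ ⌊gap θ S.level / 2⌋₊,
        {v | v ∈ S.strip θ Q l ∧ v ∈ B S f}.ncard ≤ {v | v ∈ S.strip θ Q l' ∧ v ∈ B S f}.ncard := by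
    intro S f
    obtain ⟨l, hl, hl'⟩ := Finset.exists_min_image (Finset.range (⌊gap θ S.level / 2⌋₊ + 1))
      (fun l => {v | v ∈ S.strip θ Q l ∧ v ∈ B S f}.ncard) ⟨0, by simp⟩
    exact ⟨l, by simpa [Nat.lt_succ_iff] using hl,
      fun l' h' => hl' l' (by simpa [Nat.lt_succ_iff] using h')⟩
  choose m hm hm' using hex
  let F : (S : Road) → ((T : Road) → Before Q T S → ℕ × Set (ℤ × ℤ)) → ℕ × Set (ℤ × ℤ) := fun S f =>
    (m S f, {v | v ∈ S.strip θ Q (m S f) ∧ v ∉ B S f})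
  let G : Road → ℕ × Set (ℤ × ℤ) := (before_wf Q).fix F
  have hG : ∀ S, G S = F S (fun T _ => G T) := fun S => (before_wf Q).fix_eq F S
  have hB : ∀ S v, v ∈ B S (fun T _ => G T) ↔ Blocked θ Q (fun S => (G S).2) S v := by
    intro S v
    simp only [B, Blocked, Set.mem_ofPred_eq, exists_prop]
  refine ⟨⟨fun S => (G S).2, fun S => (G S).1, fun S => ?_, fun S v => ?_, fun S l' hl' => ?_⟩⟩
  · rw [hG]; exact hm _ _
  · rw [← hB]
    simp only [hG S, F, Set.mem_ofPred_eq]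
  · have h := hm' S (fun T _ => G T) l' hl'
    simp only [hB] at h
    rw [hG S]
    exact h

/-! ### Few points of a road are blocked -/

section Cells

variable {θ : ℝ}

theorem side_pos (hθ : 1 ≤ θ) (q : ℕ) : 0 < side θ q := by unfold side; positivity

theorem one_le_side (hθ : 1 ≤ θ) (q : ℕ) : 1 ≤ side θ q := by
  have : (1 : ℝ) ≤ 2 ^ (18 * q) := one_le_pow₀ (by norm_num)
  unfold side; nlinarith

theorem one_le_gap (hθ : 1 ≤ θ) (q : ℕ) : 1 ≤ gap θ q := by
  have : (1 : ℝ) ≤ 2 ^ (16 * q) := one_le_pow₀ (by norm_num)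
  unfold gap; nlinarith

theorem cellOf_eq_iff (hθ : 1 ≤ θ) {q : ℕ} {v B : ℤ × ℤ} : cellOf θ q v = B ↔
    (B.1 * side θ q ≤ v.1 ∧ (v.1 : ℝ) < (B.1 + 1) * side θ q) ∧
      B.2 * side θ q ≤ v.2 ∧ (v.2 : ℝ) < (B.2 + 1) * side θ q := by
  have h := side_pos hθ q
  simp only [cellOf, Prod.ext_iff, Int.floor_eq_iff, le_div_iff₀ h, div_lt_iff₀ h]

theorem abs_sub_le_of_cellOf_eq (hθ : 1 ≤ θ) {q : ℕ} {v w : ℤ × ℤ}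
    (h : cellOf θ q v = cellOf θ q w) :
    |(v.1 : ℝ) - w.1| ≤ side θ q ∧ |(v.2 : ℝ) - w.2| ≤ side θ q := by
  have h1 := (cellOf_eq_iff hθ).1 h
  have h2 := (cellOf_eq_iff hθ).1 (rfl : cellOf θ q w = _)
  simp only [abs_le]
  obtain ⟨⟨a1, a2⟩, a3, a4⟩ := h1
  obtain ⟨⟨b1, b2⟩, b3, b4⟩ := h2
  refine ⟨⟨?_, ?_⟩, ?_, ?_⟩ <;> linarith

/-- The cells of the different levels are nested. -/
theorem cellOf_eq_of_le (hθ : 1 ≤ θ) {q r : ℕ} (hqr : q ≤ r) {v w : ℤ × ℤ}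
    (h : cellOf θ q v = cellOf θ q w) :
    cellOf θ r v = cellOf θ r w := by
  obtain ⟨k, rfl⟩ := Nat.exists_eq_add_of_le hqr
  have h1 : ∀ x : ℝ, ⌊x / side θ (q + k)⌋ = ⌊x / side θ q⌋ / (2 ^ (18 * k) : ℕ) := by
    intro x
    rw [← Int.floor_div_natCast]
    congr 1
    have := side_pos hθ q
    unfold side at *
    push_cast
    rw [mul_add, pow_add]
    field_simp
  simp only [cellOf, Prod.mk.injEq] at h ⊢
  rw [h1, h1, h1, h1, h.1, h.2]
  exact ⟨rfl, rfl⟩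

end Cells

namespace RoadSystem

variable {θ : ℝ} {Q : ℕ} (R : RoadSystem θ Q)

theorem level_le {S : Road} {v : ℤ × ℤ} (h : v ∈ R.A S) : S.level ≤ Q := ((R.mem_A S v).1 h).1.1

/-- Two roads have no lattice point in common. -/
theorem eq_of_mem {S T : Road} {v : ℤ × ℤ} (hS : v ∈ R.A S) (hT : v ∈ R.A T) : S = T := by
  by_contra h
  rcases before_or_before Q h with h | h
  · exact ((R.mem_A T v).1 hT).2 ⟨S, h, v, hS, rfl⟩
  · exact ((R.mem_A S v).1 hS).2 ⟨T, h, v, hT, rfl⟩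

/-- At most one road meets a cell of level `q` among the roads of level at least `2 q`: its own
avoidance cells contain that cell. -/
theorem eq_of_meet (hθ : 1 ≤ θ) {q : ℕ} {S T : Road} {v w : ℤ × ℤ} (hS : v ∈ R.A S)
    (hT : w ∈ R.A T) (hqS : 2 * q ≤ S.level) (hqT : 2 * q ≤ T.level)
    (h : cellOf θ q v = cellOf θ q w) : S = T := by
  by_contra hne
  rcases before_or_before Q hne with h' | h'
  · exact ((R.mem_A T w).1 hT).2 ⟨S, h', v, hS, cellOf_eq_of_le hθ (by omega) h⟩
  · exact ((R.mem_A S v).1 hS).2 ⟨T, h', w, hT, cellOf_eq_of_le hθ (by omega) h.symm⟩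

theorem offset_mem {S : Road} {l : ℕ} (h : l ≤ ⌊gap θ S.level / 2⌋₊) (hθ : 1 ≤ θ) :
    S.row * gap θ S.level ≤ S.offset θ l ∧ S.offset θ l ≤ (S.row + 1) * gap θ S.level := by
  have h1 : (l : ℝ) ≤ gap θ S.level / 2 :=
    (Nat.le_floor_iff (by linarith [one_le_gap hθ S.level])).1 h
  have h2 : (0 : ℝ) ≤ l := Nat.cast_nonneg l
  unfold offset
  constructor <;> linarith

theorem four_pow_mul_side_div_gap_le (hθ : 1 ≤ θ) {q r : ℕ} (hqr : q ≤ r) :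
    (4 : ℝ) ^ r * (side θ q / gap θ r) ≤ 16 ^ q := by
  have h1 : (4 : ℝ) ^ r = 2 ^ (2 * r) := by rw [pow_mul]; norm_num
  have h2 : (16 : ℝ) ^ q = 2 ^ (4 * q) := by rw [pow_mul]; norm_num
  rw [h1, h2]
  unfold side gap
  rw [mul_div_mul_left _ _ (by positivity), mul_div_assoc', div_le_iff₀ (by positivity),
    ← pow_add, ← pow_add]
  exact pow_le_pow_right₀ (by norm_num) (by omega)

/-- The roads of a level `r` between `q` and `2 q` that meet a cell of level `q`. -/
theorem exists_finset_of_level (hθ : 1 ≤ θ) {q r : ℕ} (hqr : q ≤ r) (hr : r ≤ 2 * q)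
    (v : ℤ × ℤ) :
    ∃ F : Finset Road, (F.card : ℝ) ≤ 8 * 16 ^ q ∧
      ∀ T : Road, ∀ w ∈ R.A T, T.level = r → cellOf θ q w = cellOf θ q v → T ∈ F := by
  classical
  have hg := one_le_gap hθ r
  have hD := one_le_side hθ q
  set f : ℕ → ℝ := fun a => across (2 * Real.pi * a / 4 ^ r) v.1 v.2
  let I : ℕ → Finset ℤ := fun a => Finset.Icc ⌈(f a - 2 * side θ q - 1) / gap θ r - 1⌉
    ⌊(f a + 2 * side θ q + 1) / gap θ r⌋
  have hI : ∀ a, ((I a).card : ℝ) ≤ 4 * (side θ q / gap θ r) + 4 := by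
    intro a
    have e : (f a + 2 * side θ q + 1) / gap θ r - ((f a - 2 * side θ q - 1) / gap θ r - 1) =
        4 * (side θ q / gap θ r) + 2 / gap θ r + 1 := by ring
    have h2 : 2 / gap θ r ≤ 2 := div_le_self (by norm_num) hg
    have h3 : 0 ≤ side θ q / gap θ r := by positivity
    have h4 : 0 ≤ 2 / gap θ r := by positivity
    refine (card_int_Icc_le (by linarith)).trans ?_
    linarith
  refine ⟨(Finset.range (4 ^ r)).biUnion fun a => (I a).image fun m => ⟨r, cellOf θ r v, a, m⟩,
    ?_, ?_⟩
  · have h1 := Finset.card_biUnion_le_card_mul (Finset.range (4 ^ r))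
      (fun a => (I a).image fun m => (⟨r, cellOf θ r v, a, m⟩ : Road))
      ⌊4 * (side θ q / gap θ r) + 4⌋₊
      (fun a _ => Finset.card_image_le.trans (Nat.le_floor (hI a)))
    rw [Finset.card_range] at h1
    refine (Nat.cast_le.2 h1).trans ?_
    push_cast
    have h2 := Nat.floor_le (show 0 ≤ 4 * (side θ q / gap θ r) + 4 by positivity)
    have h3 := mul_le_mul_of_nonneg_left h2 (show (0 : ℝ) ≤ 4 ^ r by positivity)
    have h4 := four_pow_mul_side_div_gap_le hθ hqr
    have h5 : (4 : ℝ) ^ r ≤ 16 ^ q := by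
      calc (4 : ℝ) ^ r ≤ 4 ^ (2 * q) := pow_le_pow_right₀ (by norm_num) hr
        _ = 16 ^ q := by rw [pow_mul]; norm_num
    linarith
  · rintro ⟨r', C, a, m⟩ w hw rfl hcell
    obtain ⟨⟨-, ha, hC, hn⟩, -⟩ := (R.mem_A _ _).1 hw
    simp only at ha hC hqr hg hI ⊢
    have hC' : C = cellOf θ r' v := by rw [← hC]; exact cellOf_eq_of_le hθ hqr hcell
    simp only [Finset.mem_biUnion, Finset.mem_range, Finset.mem_image, Road.mk.injEq, hC',
      true_and]
    refine ⟨a, ha, m, ?_, rfl, rfl⟩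
    obtain ⟨o1, o2⟩ := offset_mem (R.l_le ⟨r', C, a, m⟩) hθ
    obtain ⟨d1, d2⟩ := abs_sub_le_of_cellOf_eq hθ hcell
    have h1 := abs_across_le (Road.angle ⟨r', C, a, m⟩) ((w.1 : ℝ) - v.1) ((w.2 : ℝ) - v.2)
    rw [across_sub] at h1
    simp only [Road.angle] at h1 hn
    simp only at o1 o2
    have hs := sqrt_two_lt
    rw [abs_le] at h1 hn
    have hg0 : 0 < gap θ r' := by linarith
    have k1 : f a = across (2 * Real.pi * a / 4 ^ r') v.1 v.2 := rfl
    refine Finset.mem_Icc.2 ⟨Int.ceil_le.2 ?_, Int.le_floor.2 ?_⟩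
    · rw [sub_le_iff_le_add, div_le_iff₀ hg0, k1]
      linarith [h1.1, h1.2, hn.1, hn.2]
    · rw [le_div_iff₀ hg0, k1]
      linarith [h1.1, h1.2, hn.1, hn.2]

/-- A cell of level `q` meets `O((q + 1) 16 ^ q)` roads of level at least `q`. -/
theorem exists_finset_meet (hθ : 1 ≤ θ) (q : ℕ) (v : ℤ × ℤ) :
    ∃ F : Finset Road, (F.card : ℝ) ≤ 9 * (q + 1) * 16 ^ q ∧
      ∀ T : Road, ∀ w ∈ R.A T, q ≤ T.level → cellOf θ q w = cellOf θ q v → T ∈ F := by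
  classical
  have h0 : ∀ r : ℕ, ∃ F : Finset Road, (F.card : ℝ) ≤ 8 * 16 ^ q ∧ (q ≤ r → r ≤ 2 * q →
      ∀ T : Road, ∀ w ∈ R.A T, T.level = r → cellOf θ q w = cellOf θ q v → T ∈ F) := by
    intro r
    by_cases h : q ≤ r ∧ r ≤ 2 * q
    · obtain ⟨F, h1, h2⟩ := R.exists_finset_of_level hθ h.1 h.2 v
      exact ⟨F, h1, fun _ _ => h2⟩
    · exact ⟨∅, by simp, fun h1 h2 => absurd ⟨h1, h2⟩ h⟩
  choose F hF hF' using h0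
  obtain ⟨E, hE, hE'⟩ : ∃ E : Finset Road, E.card ≤ 1 ∧ ∀ T : Road, ∀ w ∈ R.A T,
      2 * q ≤ T.level → cellOf θ q w = cellOf θ q v → T ∈ E := by
    by_cases h : ∃ T : Road, ∃ w ∈ R.A T, 2 * q ≤ T.level ∧ cellOf θ q w = cellOf θ q v
    · obtain ⟨T, w, hw, hT, hc⟩ := h
      refine ⟨{T}, by simp, fun T' w' hw' hT' hc' => Finset.mem_singleton.2 ?_⟩
      exact R.eq_of_meet hθ hw' hw hT' hT (hc'.trans hc.symm)
    · push Not at h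
      exact ⟨∅, by simp, fun T w hw hT hc => absurd hc (h T w hw hT)⟩
  refine ⟨(Finset.Icc q (2 * q)).biUnion F ∪ E, ?_, ?_⟩
  · have h1 := Finset.card_biUnion_le_card_mul (Finset.Icc q (2 * q)) F (8 * 16 ^ q)
      (fun r _ => by exact_mod_cast hF r)
    have h2 : (Finset.Icc q (2 * q)).card = q + 1 := by rw [Nat.card_Icc]; omega
    rw [h2] at h1
    have h3 := (Finset.card_union_le ((Finset.Icc q (2 * q)).biUnion F) E).trans
      (Nat.add_le_add h1 hE)
    refine (Nat.cast_le.2 h3).trans ?_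
    push_cast
    have h4 : (1 : ℝ) ≤ 16 ^ q := one_le_pow₀ (by norm_num)
    have h5 : (0 : ℝ) ≤ q := Nat.cast_nonneg q
    nlinarith
  · intro T w hw hT hc
    by_cases h : T.level ≤ 2 * q
    · exact Finset.mem_union_left _ (Finset.mem_biUnion.2
        ⟨T.level, Finset.mem_Icc.2 ⟨hT, h⟩, hF' _ hT h T w hw rfl hc⟩)
    · exact Finset.mem_union_right _ (hE' T w hw (by omega) hc)

/-- The blocked points of the cell of `S` are contained in a set of bounded size. -/
theorem exists_finset_blocked (hθ : 1 ≤ θ) {S : Road} (hS : S.level ≤ Q) :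
    ∃ F : Finset (ℤ × ℤ), (F.card : ℝ) ≤ 180 * θ ^ 2 * 2 ^ (32 * S.level) ∧
      ∀ v, cellOf θ S.level v = S.cell → Blocked θ Q R.A S v → v ∈ F := by
  classical
  by_cases hne : ∃ v₀, cellOf θ S.level v₀ = S.cell
  swap
  · push Not at hne
    exact ⟨∅, by simp; positivity, fun v hv => absurd hv (hne v)⟩
  obtain ⟨v₀, hv₀⟩ := hne
  set q := S.level with hq
  obtain ⟨𝒯, h𝒯, h𝒯'⟩ := R.exists_finset_meet hθ q v₀
  have hD := one_le_side hθ q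
  have hr := one_le_side hθ (q / 2)
  have hcov := fun T : Road => exists_strip_cover T.angle (T.offset θ (R.l T))
    (S.cell.1 * side θ q) (S.cell.2 * side θ q) (D := side θ q) (h := 3 * side θ (q / 2))
    (by linarith) (by linarith)
  choose F hF hF' using hcov
  refine ⟨𝒯.biUnion F, ?_, ?_⟩
  · have hF2 : ∀ T, ((F T).card : ℝ) ≤ 20 * side θ q * side θ (q / 2) := by
      intro T
      refine (hF T).trans ?_
      nlinarith
    have h1 : ((𝒯.biUnion F).card : ℝ) ≤ 𝒯.card * (20 * side θ q * side θ (q / 2)) := by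
      refine (Nat.cast_le.2 Finset.card_biUnion_le).trans ?_
      push_cast
      refine (Finset.sum_le_sum fun T _ => hF2 T).trans ?_
      rw [Finset.sum_const, nsmul_eq_mul]
    have h2 : side θ (q / 2) ≤ θ * 2 ^ (9 * q) := by
      unfold side
      have : (2 : ℝ) ^ (18 * (q / 2)) ≤ 2 ^ (9 * q) := pow_le_pow_right₀ (by norm_num) (by omega)
      nlinarith
    have h3 : (q + 1 : ℝ) ≤ 2 ^ q := by exact_mod_cast Nat.lt_two_pow_self (n := q)
    have h4 : (16 : ℝ) ^ q = 2 ^ (4 * q) := by rw [pow_mul]; norm_num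
    rw [h4] at h𝒯
    calc ((𝒯.biUnion F).card : ℝ) ≤ 𝒯.card * (20 * side θ q * side θ (q / 2)) := h1
      _ ≤ (9 * 2 ^ q * 2 ^ (4 * q)) * (20 * side θ q * (θ * 2 ^ (9 * q))) := by
        gcongr
        · refine h𝒯.trans ?_
          gcongr
      _ = 180 * θ ^ 2 * (2 ^ q * 2 ^ (4 * q) * 2 ^ (18 * q) * 2 ^ (9 * q)) := by
        unfold side; ring
      _ = 180 * θ ^ 2 * 2 ^ (32 * q) := by
        rw [← pow_add, ← pow_add, ← pow_add]; ring_nf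
  · rintro v hv ⟨T, hT, w, hw, hc⟩
    have hc' := cellOf_eq_of_le hθ (show S.level / 2 ≤ S.level by omega) hc
    have hTq := hT.level_le (R.level_le hw) hS
    refine Finset.mem_biUnion.2 ⟨T, h𝒯' T w hw hTq ?_, ?_⟩
    · rw [hv₀, ← hv]; exact hc'
    · obtain ⟨⟨a1, a2⟩, a3, a4⟩ := (cellOf_eq_iff hθ).1 hv
      refine hF' T v a1 (by linarith) a3 (by linarith) ?_
      obtain ⟨⟨-, -, -, hn⟩, -⟩ := (R.mem_A _ _).1 hw
      obtain ⟨d1, d2⟩ := abs_sub_le_of_cellOf_eq hθ hc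
      have h1 := abs_across_le T.angle ((w.1 : ℝ) - v.1) ((w.2 : ℝ) - v.2)
      rw [across_sub] at h1
      have hs := sqrt_two_lt
      rw [← hq] at d1 d2
      rw [abs_le] at h1 hn ⊢
      constructor <;> linarith [h1.1, h1.2, hn.1, hn.2]

/-- Averaging over the possible offsets, few points of the strip of a road are blocked. -/
theorem ncard_blocked_le (hθ : 1 ≤ θ) {S : Road} (hS : S.level ≤ Q) :
    {v | v ∈ S.strip θ Q (R.l S) ∧ Blocked θ Q R.A S v}.Finite ∧
    ({v | v ∈ S.strip θ Q (R.l S) ∧ Blocked θ Q R.A S v}.ncard : ℝ) ≤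
      360 * gap θ S.level := by
  classical
  obtain ⟨F, hF, hF'⟩ := R.exists_finset_blocked hθ hS
  have hsub : ∀ l, {v | v ∈ S.strip θ Q l ∧ Blocked θ Q R.A S v} ⊆ (F : Set (ℤ × ℤ)) :=
    fun l v hv => hF' v hv.1.2.2.1 hv.2
  refine ⟨F.finite_toSet.subset (hsub _), ?_⟩
  set Z := {v | v ∈ S.strip θ Q (R.l S) ∧ Blocked θ Q R.A S v}.ncard
  set L := ⌊gap θ S.level / 2⌋₊
  let P : ℕ → Finset (ℤ × ℤ) := fun l => F.filter fun v =>
    v ∈ S.strip θ Q l ∧ Blocked θ Q R.A S v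
  have hP : ∀ l, {v | v ∈ S.strip θ Q l ∧ Blocked θ Q R.A S v}.ncard = (P l).card := by
    intro l
    rw [← Set.ncard_coe_finset]
    congr 1
    ext v
    simp only [P, Finset.coe_filter, Set.mem_ofPred_eq]
    exact ⟨fun h => ⟨hsub l h, h⟩, fun h => h.2⟩
  have hdisj : ∀ l ∈ Finset.range (L + 1), ∀ l' ∈ Finset.range (L + 1), l ≠ l' →
      Disjoint (P l) (P l') := by
    intro l _ l' _ hne
    rw [Finset.disjoint_left]
    intro v hv hv'
    have h1 := (Finset.mem_filter.1 hv).2.1.2.2.2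
    have h2 := (Finset.mem_filter.1 hv').2.1.2.2.2
    unfold offset at h1 h2
    have hs := sqrt_two_lt
    rw [abs_le] at h1 h2
    have h3 : (l : ℝ) < l' + 1 := by linarith [h1.1, h2.2]
    have h4 : (l' : ℝ) < l + 1 := by linarith [h1.2, h2.1]
    have h5 : l < l' + 1 := by exact_mod_cast h3
    have h6 : l' < l + 1 := by exact_mod_cast h4
    omega
  have hsum : (L + 1) * Z ≤ F.card := by
    calc (L + 1) * Z = ∑ l ∈ Finset.range (L + 1), Z := by simp
      _ ≤ ∑ l ∈ Finset.range (L + 1), (P l).card := by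
        refine Finset.sum_le_sum fun l hl => ?_
        rw [← hP]
        exact R.minimal S l (by simpa [Nat.lt_succ_iff] using hl)
      _ = ((Finset.range (L + 1)).biUnion P).card := (Finset.card_biUnion hdisj).symm
      _ ≤ F.card := Finset.card_le_card
        (Finset.biUnion_subset.2 fun l _ => Finset.filter_subset _ _)
  have h1 : ((L + 1) * Z : ℝ) ≤ 180 * θ ^ 2 * 2 ^ (32 * S.level) := by
    refine le_trans ?_ hF
    exact_mod_cast hsum
  have h2 : gap θ S.level / 2 ≤ L + 1 := (Nat.lt_floor_add_one _).le
  have h3 : (0 : ℝ) ≤ Z := Nat.cast_nonneg _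
  have hg := one_le_gap hθ S.level
  have h4 : 180 * θ ^ 2 * 2 ^ (32 * S.level) = 180 * gap θ S.level * gap θ S.level := by
    unfold gap
    rw [show 32 * S.level = 16 * S.level + 16 * S.level by ring, pow_add]; ring
  rw [h4] at h1
  have h5 : gap θ S.level / 2 * Z ≤ 180 * gap θ S.level * gap θ S.level :=
    (mul_le_mul_of_nonneg_right h2 h3).trans h1
  nlinarith

end RoadSystem

/-! ### Travelling within a cell -/

/-- Every vector is nearly parallel to one of `k` equidistributed directions. -/
theorem exists_dir (x y : ℝ) {k : ℕ} (hk : 4 ≤ k) : ∃ a < k,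
    0 ≤ along (2 * Real.pi * a / k) x y ∧
      |across (2 * Real.pi * a / k) x y| ≤ √(x ^ 2 + y ^ 2) * (2 * Real.pi / k) := by
  have hk' : (4 : ℝ) ≤ k := by exact_mod_cast hk
  have hpi := Real.pi_pos
  obtain ⟨φ, h0, h1, hx, hy⟩ : ∃ φ : ℝ, 0 ≤ φ ∧ φ < 2 * Real.pi ∧
      √(x ^ 2 + y ^ 2) * Real.cos φ = x ∧ √(x ^ 2 + y ^ 2) * Real.sin φ = y := by
    have hn : ‖(⟨x, y⟩ : ℂ)‖ = √(x ^ 2 + y ^ 2) := Complex.norm_eq_sqrt_sq_add_sq _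
    have hc := Complex.norm_mul_cos_arg (⟨x, y⟩ : ℂ)
    have hs := Complex.norm_mul_sin_arg (⟨x, y⟩ : ℂ)
    rw [hn] at hc hs
    have a1 := Complex.neg_pi_lt_arg (⟨x, y⟩ : ℂ)
    have a2 := Complex.arg_le_pi (⟨x, y⟩ : ℂ)
    rcases lt_or_ge (Complex.arg ⟨x, y⟩) 0 with h | h
    · exact ⟨Complex.arg ⟨x, y⟩ + 2 * Real.pi, by linarith, by linarith,
        by rw [Real.cos_add_two_pi]; exact hc, by rw [Real.sin_add_two_pi]; exact hs⟩
    · exact ⟨Complex.arg ⟨x, y⟩, h, by linarith, hc, hs⟩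
  set r := √(x ^ 2 + y ^ 2)
  have hr : 0 ≤ r := Real.sqrt_nonneg _
  set a := ⌊φ * k / (2 * Real.pi)⌋₊
  have ha1 : (a : ℝ) ≤ φ * k / (2 * Real.pi) := Nat.floor_le (by positivity)
  have ha2 : φ * k / (2 * Real.pi) < a + 1 := Nat.lt_floor_add_one _
  rw [le_div_iff₀ (by positivity)] at ha1
  rw [div_lt_iff₀ (by positivity)] at ha2
  set β := 2 * Real.pi * a / k
  have e1 : along β x y = r * Real.cos (φ - β) := by
    unfold along; rw [Real.cos_sub, ← hx, ← hy]; ring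
  have e2 : across β x y = r * Real.sin (φ - β) := by
    unfold across; rw [Real.sin_sub, ← hx, ← hy]; ring
  have hd0 : 0 ≤ φ - β := by
    rw [sub_nonneg, div_le_iff₀ (by linarith)]; linarith
  have hd1 : φ - β ≤ 2 * Real.pi / k := by
    rw [sub_le_iff_le_add, ← add_div, le_div_iff₀ (by linarith)]; linarith
  have hd2 : 2 * Real.pi / k ≤ Real.pi / 2 := by
    rw [div_le_iff₀ (by linarith)]; nlinarith
  refine ⟨a, ?_, ?_, ?_⟩
  · have : (a : ℝ) < k := by
      have : (a : ℝ) * (2 * Real.pi) < k * (2 * Real.pi) := by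
        have := mul_lt_mul_of_pos_right h1 (show (0 : ℝ) < k by linarith)
        linarith
      exact lt_of_mul_lt_mul_right this (by linarith)
    exact_mod_cast this
  · rw [e1]
    exact mul_nonneg hr (Real.cos_nonneg_of_neg_pi_div_two_le_of_le (by linarith) (by linarith))
  · rw [e2, abs_mul, abs_of_nonneg hr]
    refine mul_le_mul_of_nonneg_left (Real.abs_sin_le_abs.trans ?_) hr
    rwa [abs_of_nonneg hd0]

namespace RoadSystem

variable {θ : ℝ} {Q : ℕ} (R : RoadSystem θ Q)

open Classical in
/-- The line system of a system of roads. -/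
noncomputable def lines : LineSystem Road where
  own v := if h : ∃ S, v ∈ R.A S then some h.choose else none
  ang := Road.angle
  off S := S.offset θ (R.l S)
  near v S h := by
    split_ifs at h with h'
    obtain rfl := Option.some.inj h
    exact ((R.mem_A _ _).1 h'.choose_spec).1.2.2.2

theorem own_of_mem {S : Road} {v : ℤ × ℤ} (h : v ∈ R.A S) : R.lines.own v = some S := by
  have h' : ∃ S, v ∈ R.A S := ⟨S, h⟩
  have : R.lines.own v = some h'.choose := dif_pos h'
  rw [this, R.eq_of_mem h'.choose_spec h]

/-- Along the strip of a road one travels at the cost of the distance plus a constant for each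
blocked point. -/
theorem reach_along (hθ : 1 ≤ θ) {S : Road} (hS : S.level ≤ Q) (hdir : S.dir < 4 ^ S.level)
    {n : ℕ} {T : ℝ} (u : Fin n × Fin n)
    (hu : |across S.angle (lat u).1 (lat u).2 - S.offset θ (R.l S)| ≤ √2 / 2)
    (huT : along S.angle (lat u).1 (lat u).2 ≤ T + 1)
    (hbox : ∀ w : ℤ × ℤ, |across S.angle w.1 w.2 - S.offset θ (R.l S)| ≤ √2 / 2 →
      along S.angle (lat u).1 (lat u).2 ≤ along S.angle w.1 w.2 →
      along S.angle w.1 w.2 ≤ T + 1 → cellOf θ S.level w = S.cell ∧ InGrid n w) :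
    ∃ w : Fin n × Fin n, |across S.angle (lat w).1 (lat w).2 - S.offset θ (R.l S)| ≤ √2 / 2 ∧
      T ≤ along S.angle (lat w).1 (lat w).2 ∧ along S.angle (lat w).1 (lat w).2 ≤ T + 1 ∧
      R.lines.Reach u w (along S.angle (lat w).1 (lat w).2 - along S.angle (lat u).1 (lat u).2 +
        2880 * gap θ S.level) := by
  classical
  obtain ⟨g, hg0, hgs, hgn, hginj, hg1, hg2, hg3⟩ := exists_digital_line _ _ _ hu
  set t : ℕ → ℝ := fun i => along S.angle (g i).1 (g i).2 with ht
  have htm : Monotone t := monotone_nat_of_le_succ hg1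
  have ht0 : t 0 = along S.angle (lat u).1 (lat u).2 := by simp only [ht, hg0]
  have hex := hg3 T
  set N := Nat.find hex
  have hN : T ≤ t N := Nat.find_spec hex
  have hN1 : t N ≤ T + 1 := by
    rcases Nat.eq_zero_or_pos N with h | h
    · rw [h, ht0]; exact huT
    · have h1 := Nat.find_min hex (show N - 1 < N by omega)
      have h2 := hg2 (N - 1)
      rw [Nat.sub_add_cancel h] at h2
      push Not at h1
      simp only [ht]
      linarith
  have hin : ∀ i ≤ N, cellOf θ S.level (g i) = S.cell ∧ InGrid n (g i) := fun i hi =>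
    hbox (g i) (hgs i) (by rw [← ht0]; exact htm (Nat.zero_le i)) ((htm hi).trans hN1)
  have hstrip : ∀ i ≤ N, g i ∈ S.strip θ Q (R.l S) := fun i hi => ⟨hS, hdir, (hin i hi).1, hgs i⟩
  obtain ⟨w, hw⟩ := (hin N le_rfl).2.exists_lat
  refine ⟨w, by rw [hw]; exact hgs N, by rw [hw]; exact hN, by rw [hw]; exact hN1, ?_⟩
  refine (Reach.of_seq g N (fun i hi => (hin i hi).2) (fun i _ => hgn i) hg0.symm hw).mono ?_
  obtain ⟨hfin, hcard⟩ := R.ncard_blocked_le hθ hS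
  -- a step costs its displacement along the line unless one of its ends is blocked
  let χ : ℕ → ℝ := fun i => if Blocked θ Q R.A S (g i) then 1 else 0
  have hχ0 : ∀ i, 0 ≤ χ i := fun i => by simp only [χ]; split_ifs <;> norm_num
  have hcost : ∀ i ∈ Finset.range N, (R.lines.cost (g i) (g (i + 1)) : ℝ) ≤
      (t (i + 1) - t i) + 4 * χ i + 4 * χ (i + 1) := by
    intro i hi
    have hi := Finset.mem_range.1 hi
    have h0 : 0 ≤ t (i + 1) - t i := sub_nonneg.2 (hg1 i)
    by_cases h1 : Blocked θ Q R.A S (g i)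
    · have : χ i = 1 := if_pos h1
      have := R.lines.cost_le (hgn i)
      linarith [hχ0 (i + 1)]
    by_cases h2 : Blocked θ Q R.A S (g (i + 1))
    · have : χ (i + 1) = 1 := if_pos h2
      have := R.lines.cost_le (hgn i)
      linarith [hχ0 i]
    · have m1 := R.own_of_mem ((R.mem_A S _).2 ⟨hstrip i (by omega), h1⟩)
      have m2 := R.own_of_mem ((R.mem_A S _).2 ⟨hstrip (i + 1) (by omega), h2⟩)
      rw [R.lines.cost_of_own m1 m2, abs_sub_comm]
      have : |t (i + 1) - t i| = t (i + 1) - t i := abs_of_nonneg h0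
      have h3 := hχ0 i
      have h4 := hχ0 (i + 1)
      refine le_trans (le_of_eq this) (by linarith)
  have hsum : ∀ k ≤ 1, ∑ i ∈ Finset.range N, χ (i + k) ≤
      360 * gap θ S.level := by
    intro k hk
    refine le_trans ?_ hcard
    simp only [χ]
    rw [Finset.sum_boole]
    have : ((Finset.range N).filter fun i => Blocked θ Q R.A S (g (i + k))).card =
        (((Finset.range N).filter fun i => Blocked θ Q R.A S (g (i + k))).image
          fun i => g (i + k)).card :=
      (Finset.card_image_of_injective _ fun i j h => by
        have := hginj h
        omega).symm
    rw [this, ← Set.ncard_coe_finset]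
    refine Nat.cast_le.2 (Set.ncard_le_ncard ?_ hfin)
    intro v hv
    simp only [Finset.coe_image, Finset.coe_filter, Set.mem_image, Finset.mem_range] at hv
    obtain ⟨i, ⟨hi, hb⟩, rfl⟩ := hv
    exact ⟨hstrip _ (by omega), hb⟩
  refine (Finset.sum_le_sum hcost).trans ?_
  rw [Finset.sum_add_distrib, Finset.sum_add_distrib, Finset.sum_range_sub, ← Finset.mul_sum,
    ← Finset.mul_sum, hw, ← ht0]
  have s1 := hsum 0 (by omega)
  have s2 := hsum 1 le_rfl
  simp only [Nat.add_zero] at s1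
  have : t N = along S.angle (g N).1 (g N).2 := rfl
  linarith

end RoadSystem

/-- The first coordinate from the rotated coordinates. -/
theorem fst_eq (α x y : ℝ) : x = along α x y * Real.cos α - across α x y * Real.sin α := by
  unfold along across; linear_combination -x * Real.sin_sq_add_cos_sq α

/-- The second coordinate from the rotated coordinates. -/
theorem snd_eq (α x y : ℝ) : y = along α x y * Real.sin α + across α x y * Real.cos α := by
  unfold along across; linear_combination -y * Real.sin_sq_add_cos_sq α

theorem mul_mem_of_abs_le_one {κ lo hi t₁ t₂ t : ℝ} (hκ : |κ| ≤ 1) (h1 : t₁ - 1 ≤ t)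
    (h2 : t ≤ t₂ + 1) (hlo₁ : lo ≤ t₁ * κ) (hlo₂ : lo ≤ t₂ * κ) (hhi₁ : t₁ * κ ≤ hi)
    (hhi₂ : t₂ * κ ≤ hi) : lo - 1 ≤ t * κ ∧ t * κ ≤ hi + 1 := by
  rw [abs_le] at hκ
  rcases le_total 0 κ with h | h
  · constructor <;> nlinarith [hκ.1, hκ.2]
  · constructor <;> nlinarith [hκ.1, hκ.2]

theorem mul_abs_le_one {κ f d : ℝ} (hκ : |κ| ≤ 1) (hf : |f| ≤ d) : |f * κ| ≤ d := by
  rw [abs_mul]; nlinarith [abs_nonneg f, abs_nonneg κ]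

/-- Near every point of a line there is a lattice point in the strip of half-width `√2 / 2`: round
both coordinates to a nearest integer. -/
theorem exists_lattice_point (α t c : ℝ) :
    ∃ w : ℤ × ℤ, |across α w.1 w.2 - c| ≤ √2 / 2 ∧ |along α w.1 w.2 - t| ≤ 1 := by
  obtain ⟨x, y, hx, hy⟩ : ∃ x y : ℝ, along α x y = t ∧ across α x y = c := by
    refine ⟨t * Real.cos α - c * Real.sin α, t * Real.sin α + c * Real.cos α, ?_, ?_⟩
    · unfold along; linear_combination t * Real.sin_sq_add_cos_sq α
    · unfold across; linear_combination c * Real.sin_sq_add_cos_sq α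
  have r1 : |(round x : ℝ) - x| ≤ 1 / 2 := by rw [abs_sub_comm]; exact abs_sub_round x
  have r2 : |(round y : ℝ) - y| ≤ 1 / 2 := by rw [abs_sub_comm]; exact abs_sub_round y
  have hcs := abs_cos_add_abs_sin_le α
  have hs2 := sqrt_two_lt
  have m1 := mul_le_mul_of_nonneg_right r1 (abs_nonneg (Real.cos α))
  have m2 := mul_le_mul_of_nonneg_right r2 (abs_nonneg (Real.sin α))
  have m3 := mul_le_mul_of_nonneg_right r2 (abs_nonneg (Real.cos α))
  have m4 := mul_le_mul_of_nonneg_right r1 (abs_nonneg (Real.sin α))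
  refine ⟨(round x, round y), ?_, ?_⟩
  · rw [← hy, ← across_sub]
    unfold across
    refine (abs_sub _ _).trans ?_
    rw [abs_mul, abs_mul]
    linarith
  · rw [← hx, ← along_sub]
    refine (abs_along_le _ _ _).trans ?_
    linarith

/-- A point whose rotated coordinates are nearly between those of two points of a box is close to
that box. -/
theorem mem_box_of_rotated {α a b a' b' d p₁ p₂ q₁ q₂ x y : ℝ}
    (hp₁ : a ≤ p₁ ∧ p₁ ≤ a') (hp₂ : b ≤ p₂ ∧ p₂ ≤ b') (hq₁ : a ≤ q₁ ∧ q₁ ≤ a')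
    (hq₂ : b ≤ q₂ ∧ q₂ ≤ b') (h1 : along α p₁ p₂ - 1 ≤ along α x y)
    (h2 : along α x y ≤ along α q₁ q₂ + 1) (hp : |across α x y - across α p₁ p₂| ≤ d)
    (hq : |across α x y - across α q₁ q₂| ≤ d) :
    (a - d - 1 ≤ x ∧ x ≤ a' + d + 1) ∧ b - d - 1 ≤ y ∧ y ≤ b' + d + 1 := by
  have hc := Real.abs_cos_le_one α
  have hs := Real.abs_sin_le_one α
  have ex := fst_eq α x y
  have ey := snd_eq α x y
  have ep := fst_eq α p₁ p₂
  have ep' := snd_eq α p₁ p₂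
  have eq := fst_eq α q₁ q₂
  have eq' := snd_eq α q₁ q₂
  have a1 := abs_le.1 (mul_abs_le_one hs hp)
  have a2 := abs_le.1 (mul_abs_le_one hs hq)
  have a3 := abs_le.1 (mul_abs_le_one hc hp)
  have a4 := abs_le.1 (mul_abs_le_one hc hq)
  obtain ⟨x1, x2⟩ := mul_mem_of_abs_le_one (lo := a - d + across α x y * Real.sin α)
    (hi := a' + d + across α x y * Real.sin α) hc h1 h2 (by linarith) (by linarith)
    (by linarith) (by linarith)
  obtain ⟨y1, y2⟩ := mul_mem_of_abs_le_one (lo := b - d - across α x y * Real.cos α)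
    (hi := b' + d - across α x y * Real.cos α) hs h1 h2 (by linarith) (by linarith)
    (by linarith) (by linarith)
  refine ⟨⟨?_, ?_⟩, ?_, ?_⟩ <;> linarith

/-- Contracting an interval of length `D` towards its midpoint by the factor `1 - ε`. -/
theorem contract_mem {a D ε p : ℝ} (hε0 : 0 ≤ ε) (hε1 : ε ≤ 1) (h1 : a ≤ p) (h2 : p ≤ a + D) :
    (a + ε * D / 2 ≤ a + D / 2 + (1 - ε) * (p - (a + D / 2)) ∧
      a + D / 2 + (1 - ε) * (p - (a + D / 2)) ≤ a + D - ε * D / 2) ∧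
      |a + D / 2 + (1 - ε) * (p - (a + D / 2)) - p| ≤ ε * D / 2 := by
  rw [abs_le]
  refine ⟨⟨?_, ?_⟩, ?_, ?_⟩ <;> nlinarith

namespace RoadSystem

variable {θ : ℝ} {Q : ℕ} (R : RoadSystem θ Q)

theorem side_eq_gap_mul (θ : ℝ) (q : ℕ) : side θ q = gap θ q * 4 ^ q := by
  unfold side gap
  rw [show (4 : ℝ) = 2 ^ 2 by norm_num, ← pow_mul, mul_assoc, ← pow_add]
  ring_nf

/-- Two points of a cell that keep away from its boundary are joined along one road. The line of the
road is within the spacing of the first point, and it misses the second one by at most `19 / 2`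
spacings more; with the width of the strip this keeps all points within `25 / 2` spacings of the
bounding box of the two points, and hence in the cell. -/
theorem reach_inner (hθ : 1 ≤ θ) {q n : ℕ} (hq3 : 3 ≤ q) (hqQ : q ≤ Q) {i j : ℤ}
    (hi : 0 ≤ i) (hj : 0 ≤ j) (hin : (i + 1) * side θ q ≤ n) (hjn : (j + 1) * side θ q ≤ n)
    {p₁ p₂ q₁ q₂ : ℝ}
    (hp₁ : i * side θ q + 14 * gap θ q ≤ p₁ ∧ p₁ ≤ i * side θ q + side θ q - 14 * gap θ q)
    (hp₂ : j * side θ q + 14 * gap θ q ≤ p₂ ∧ p₂ ≤ j * side θ q + side θ q - 14 * gap θ q)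
    (hq₁ : i * side θ q + 14 * gap θ q ≤ q₁ ∧ q₁ ≤ i * side θ q + side θ q - 14 * gap θ q)
    (hq₂ : j * side θ q + 14 * gap θ q ≤ q₂ ∧ q₂ ≤ j * side θ q + side θ q - 14 * gap θ q) :
    ∃ u v : Fin n × Fin n, (|((lat u).1 : ℝ) - p₁| ≤ 13 * gap θ q ∧
      |((lat u).2 : ℝ) - p₂| ≤ 13 * gap θ q) ∧
      (|((lat v).1 : ℝ) - q₁| ≤ 13 * gap θ q ∧ |((lat v).2 : ℝ) - q₂| ≤ 13 * gap θ q) ∧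
      R.lines.Reach u v (√((q₁ - p₁) ^ 2 + (q₂ - p₂) ^ 2) + 2882 * gap θ q) := by
  have hg := one_le_gap hθ q
  have hD := side_pos hθ q
  have hk4 : 4 ≤ 4 ^ q := by
    calc 4 = 4 ^ 1 := by norm_num
      _ ≤ 4 ^ q := Nat.pow_le_pow_right (by norm_num) (by omega)
  have hs2 := sqrt_two_lt
  obtain ⟨a, ha, hal, hac⟩ := exists_dir (q₁ - p₁) (q₂ - p₂) hk4
  push_cast at hal hac
  set α := 2 * Real.pi * a / 4 ^ q
  set r := √((q₁ - p₁) ^ 2 + (q₂ - p₂) ^ 2)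
  have hr : r ≤ 3 / 2 * side θ q := by
    refine Real.sqrt_le_iff.2 ⟨by positivity, ?_⟩
    have b1 : (q₁ - p₁) ^ 2 ≤ side θ q ^ 2 := sq_le_sq' (by linarith) (by linarith)
    have b2 : (q₂ - p₂) ^ 2 ≤ side θ q ^ 2 := sq_le_sq' (by linarith) (by linarith)
    nlinarith
  -- the chosen direction misses by at most the spacing times a constant
  have hac' : |across α (q₁ - p₁) (q₂ - p₂)| ≤ 19 / 2 * gap θ q := by
    refine hac.trans ?_
    have h4 : (0 : ℝ) < 4 ^ q := by positivity
    calc r * (2 * Real.pi / 4 ^ q) ≤ 3 / 2 * side θ q * (2 * Real.pi / 4 ^ q) := by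
          gcongr
      _ = 3 * Real.pi * gap θ q := by rw [side_eq_gap_mul]; field_simp
      _ ≤ 19 / 2 * gap θ q := by
        gcongr; linarith [Real.pi_lt_d2]
  rw [along_sub] at hal
  rw [across_sub] at hac'
  have hlen : along α q₁ q₂ - along α p₁ p₂ ≤ r := by
    rw [← along_sub]
    refine (le_abs_self _).trans (Real.abs_le_sqrt ?_)
    exact le_of_le_of_eq (le_add_of_nonneg_right (sq_nonneg _)) (along_sq_add_across_sq _ _ _)
  let S : Road := ⟨q, (i, j), a, ⌊across α p₁ p₂ / gap θ q⌋⟩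
  set c := S.offset θ (R.l S) with hc
  have hcp : |across α p₁ p₂ - c| ≤ gap θ q := by
    obtain ⟨o1, o2⟩ := offset_mem (R.l_le S) hθ
    have f1 := Int.floor_le (across α p₁ p₂ / gap θ q)
    have f2 := Int.lt_floor_add_one (across α p₁ p₂ / gap θ q)
    rw [le_div_iff₀ (by linarith)] at f1
    rw [div_lt_iff₀ (by linarith)] at f2
    simp only [S] at o1 o2
    rw [abs_le]
    constructor <;> linarith
  have hang : S.angle = α := rfl
  -- lattice points of the strip between the two points are close to the segment joining them
  have hclose : ∀ w : ℤ × ℤ, |across α w.1 w.2 - c| ≤ √2 / 2 →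
      |across α w.1 w.2 - across α p₁ p₂| ≤ 23 / 2 * gap θ q ∧
        |across α w.1 w.2 - across α q₁ q₂| ≤ 23 / 2 * gap θ q := by
    intro w hw
    rw [abs_le] at hw hcp hac' ⊢
    rw [abs_le]
    refine ⟨⟨?_, ?_⟩, ?_, ?_⟩ <;> linarith [hw.1, hw.2, hcp.1, hcp.2, hac'.1, hac'.2]
  have hbox : ∀ w : ℤ × ℤ, |across α w.1 w.2 - c| ≤ √2 / 2 →
      along α p₁ p₂ - 1 ≤ along α w.1 w.2 → along α w.1 w.2 ≤ along α q₁ q₂ + 1 →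
      cellOf θ q w = (i, j) ∧ InGrid n w := by
    intro w hw h1 h2
    obtain ⟨c1, c2⟩ := hclose w hw
    obtain ⟨⟨x1, x2⟩, y1, y2⟩ := mem_box_of_rotated hp₁ hp₂ hq₁ hq₂ h1 h2 c1 c2
    have hi' : (0 : ℝ) ≤ i := by exact_mod_cast hi
    have hj' : (0 : ℝ) ≤ j := by exact_mod_cast hj
    have z1 : 0 ≤ i * side θ q := by positivity
    have z2 : 0 ≤ j * side θ q := by positivity
    refine ⟨(cellOf_eq_iff hθ).2 ⟨⟨?_, ?_⟩, ?_, ?_⟩, ⟨?_, ?_⟩, ?_, ?_⟩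
    · simp only; linarith
    · simp only; linarith
    · simp only; linarith
    · simp only; linarith
    · have : (0 : ℝ) ≤ w.1 := by linarith
      exact_mod_cast this
    · have : (w.1 : ℝ) < n := by linarith
      exact_mod_cast this
    · have : (0 : ℝ) ≤ w.2 := by linarith
      exact_mod_cast this
    · have : (w.2 : ℝ) < n := by linarith
      exact_mod_cast this
  obtain ⟨w₀, hac0, hal0⟩ := exists_lattice_point α (along α p₁ p₂) c
  rw [abs_le] at hal0
  obtain ⟨-, hin0⟩ := hbox w₀ hac0 (by linarith [hal0.1]) (by linarith [hal0.2])
  obtain ⟨u, hu⟩ := hin0.exists_lat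
  obtain ⟨v, hv1, hv2, hv3, hv4⟩ := R.reach_along hθ (S := S) hqQ ha (T := along α q₁ q₂) u
    (by rw [hu, hang]; exact hac0) (by rw [hu, hang]; linarith [hal0.2])
    (fun w h1 h2 h3 => hbox w h1 (by
      rw [hu, hang] at h2; linarith [hal0.1]) h3)
  rw [hang] at hv1 hv2 hv3 hv4
  refine ⟨u, v, ?_, ?_, hv4.mono ?_⟩
  · have h := mem_box_of_rotated (α := α) (d := 23 / 2 * gap θ q) (x := (lat u).1) (y := (lat u).2)
      ⟨le_rfl, le_rfl⟩ ⟨le_rfl, le_rfl⟩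
      ⟨le_rfl, le_rfl⟩ ⟨le_rfl, le_rfl⟩
      (p₁ := p₁) (p₂ := p₂) (by rw [hu]; linarith [hal0.1])
      (by rw [hu]; linarith [hal0.2]) (hclose _ (by rw [hu]; exact hac0)).1
      (hclose _ (by rw [hu]; exact hac0)).1
    rw [abs_le, abs_le]
    refine ⟨⟨?_, ?_⟩, ?_, ?_⟩ <;> linarith [h.1.1, h.1.2, h.2.1, h.2.2]
  · have h := mem_box_of_rotated (α := α) (d := 23 / 2 * gap θ q) (x := (lat v).1) (y := (lat v).2)
      ⟨le_rfl, le_rfl⟩ ⟨le_rfl, le_rfl⟩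
      ⟨le_rfl, le_rfl⟩ ⟨le_rfl, le_rfl⟩
      (p₁ := q₁) (p₂ := q₂) (by linarith) hv3 (hclose _ hv1).2 (hclose _ hv1).2
    rw [abs_le, abs_le]
    refine ⟨⟨?_, ?_⟩, ?_, ?_⟩ <;> linarith [h.1.1, h.1.2, h.2.1, h.2.2]
  · rw [hu]
    have : gap θ S.level = gap θ q := rfl
    rw [this]
    linarith [hal0.1]

/-- Vertices close to two points of one closed cell are joined at the cost of the distance of these
points plus a multiple of the spacing. -/
theorem reach_cell (hθ : 1 ≤ θ) {q n : ℕ} (hq3 : 3 ≤ q) (hqQ : q ≤ Q) {i j : ℤ}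
    (hi : 0 ≤ i) (hj : 0 ≤ j) (hin : (i + 1) * side θ q ≤ n) (hjn : (j + 1) * side θ q ≤ n)
    {p₁ p₂ q₁ q₂ : ℝ}
    (hp₁ : i * side θ q ≤ p₁ ∧ p₁ ≤ i * side θ q + side θ q)
    (hp₂ : j * side θ q ≤ p₂ ∧ p₂ ≤ j * side θ q + side θ q)
    (hq₁ : i * side θ q ≤ q₁ ∧ q₁ ≤ i * side θ q + side θ q)
    (hq₂ : j * side θ q ≤ q₂ ∧ q₂ ≤ j * side θ q + side θ q)
    {u v : Fin n × Fin n} (hu : |((lat u).1 : ℝ) - p₁| ≤ 1 ∧ |((lat u).2 : ℝ) - p₂| ≤ 1)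
    (hv : |((lat v).1 : ℝ) - q₁| ≤ 1 ∧ |((lat v).2 : ℝ) - q₂| ≤ 1) :
    R.lines.Reach u v (√((q₁ - p₁) ^ 2 + (q₂ - p₂) ^ 2) + 3330 * gap θ q) := by
  have hg := one_le_gap hθ q
  have h64 : (64 : ℝ) ≤ 4 ^ q := by
    calc (64 : ℝ) = 4 ^ 3 := by norm_num
      _ ≤ 4 ^ q := pow_le_pow_right₀ (by norm_num) hq3
  -- the contraction by `1 - ε` creates the margin of `14` spacings at the boundary of the cell
  set ε : ℝ := 28 / 4 ^ q with hε
  have hε0 : 0 ≤ ε := by positivity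
  have hε1 : ε ≤ 1 := by rw [hε, div_le_one (by positivity)]; linarith
  have hεD : ε * side θ q / 2 = 14 * gap θ q := by
    rw [side_eq_gap_mul, hε]; field_simp; norm_num
  obtain ⟨m1, d1⟩ := contract_mem hε0 hε1 hp₁.1 hp₁.2
  obtain ⟨m2, d2⟩ := contract_mem hε0 hε1 hp₂.1 hp₂.2
  obtain ⟨m3, d3⟩ := contract_mem hε0 hε1 hq₁.1 hq₁.2
  obtain ⟨m4, d4⟩ := contract_mem hε0 hε1 hq₂.1 hq₂.2
  rw [hεD] at m1 m2 m3 m4 d1 d2 d3 d4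
  obtain ⟨u', v', hu', hv', h⟩ := R.reach_inner hθ hq3 hqQ hi hj hin hjn m1 m2 m3 m4
  have hcontr : √((i * side θ q + side θ q / 2 + (1 - ε) * (q₁ - (i * side θ q + side θ q / 2)) -
      (i * side θ q + side θ q / 2 + (1 - ε) * (p₁ - (i * side θ q + side θ q / 2)))) ^ 2 +
      (j * side θ q + side θ q / 2 + (1 - ε) * (q₂ - (j * side θ q + side θ q / 2)) -
      (j * side θ q + side θ q / 2 + (1 - ε) * (p₂ - (j * side θ q + side θ q / 2)))) ^ 2) ≤
      √((q₁ - p₁) ^ 2 + (q₂ - p₂) ^ 2) := by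
    apply Real.sqrt_le_sqrt
    have e : (1 - ε) ^ 2 ≤ 1 := by nlinarith
    have s1 := mul_le_mul_of_nonneg_right e (sq_nonneg (q₁ - p₁))
    have s2 := mul_le_mul_of_nonneg_right e (sq_nonneg (q₂ - p₂))
    refine le_trans (le_of_eq ?_) (le_trans (add_le_add s1 s2) (by rw [one_mul, one_mul]))
    ring
  refine (((reach_l1 u u').trans h).trans (reach_l1 v' v)).mono ?_
  have t1 : |((lat u).1 : ℝ) - (lat u').1| ≤ 28 * gap θ q := by
    have := hu.1; have := hu'.1
    rw [abs_le] at *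
    constructor <;> linarith
  have t2 : |((lat u).2 : ℝ) - (lat u').2| ≤ 28 * gap θ q := by
    have := hu.2; have := hu'.2
    rw [abs_le] at *
    constructor <;> linarith
  have t3 : |((lat v').1 : ℝ) - (lat v).1| ≤ 28 * gap θ q := by
    have := hv.1; have := hv'.1
    rw [abs_le] at *
    constructor <;> linarith
  have t4 : |((lat v').2 : ℝ) - (lat v).2| ≤ 28 * gap θ q := by
    have := hv.2; have := hv'.2
    rw [abs_le] at *
    constructor <;> linarith
  linarith

end RoadSystem

/-! ### Travelling between cells -/

/-- A segment of length at most `D` on the line meets at most two of the intervals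
`[i D, (i + 1) D]`, one after the other. -/
theorem exists_crossing {D x₁ x₂ : ℝ} (hD : 0 < D) (h : |x₁ - x₂| ≤ D) :
    ∃ τ : ℝ, (0 ≤ τ ∧ τ ≤ 1) ∧
      (∀ σ, 0 ≤ σ → σ ≤ τ → ⌊x₁ / D⌋ * D ≤ x₁ + σ * (x₂ - x₁) ∧
        x₁ + σ * (x₂ - x₁) ≤ ⌊x₁ / D⌋ * D + D) ∧
      ∀ σ, τ ≤ σ → σ ≤ 1 → ⌊x₂ / D⌋ * D ≤ x₁ + σ * (x₂ - x₁) ∧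
        x₁ + σ * (x₂ - x₁) ≤ ⌊x₂ / D⌋ * D + D := by
  have a1 := Int.floor_le (x₁ / D)
  have a2 := Int.lt_floor_add_one (x₁ / D)
  have b1 := Int.floor_le (x₂ / D)
  have b2 := Int.lt_floor_add_one (x₂ / D)
  rw [le_div_iff₀ hD] at a1 b1
  rw [div_lt_iff₀ hD] at a2 b2
  rw [abs_le] at h
  generalize ⌊x₁ / D⌋ = i at *
  generalize ⌊x₂ / D⌋ = j at *
  have c1 : (i : ℝ) < j + 2 := by nlinarith
  have c2 : (j : ℝ) < i + 2 := by nlinarith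
  have c1' : i < j + 2 := by exact_mod_cast c1
  have c2' : j < i + 2 := by exact_mod_cast c2
  obtain rfl | rfl | rfl : j = i ∨ j = i + 1 ∨ i = j + 1 := by omega
  · refine ⟨1, ⟨by norm_num, le_rfl⟩, fun σ h0 h1 => ?_, fun σ h0 h1 => ?_⟩
    · constructor <;> nlinarith
    · obtain rfl : σ = 1 := le_antisymm h1 h0
      constructor <;> linarith
  · push_cast at *
    have hlt : 0 < x₂ - x₁ := by linarith
    refine ⟨((i + 1) * D - x₁) / (x₂ - x₁), ⟨div_nonneg (by linarith) hlt.le,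
      (div_le_one hlt).2 (by linarith)⟩, fun σ h0 h1 => ?_, fun σ h0 h1 => ?_⟩
    · rw [le_div_iff₀ hlt] at h1
      constructor <;> nlinarith
    · rw [div_le_iff₀ hlt] at h0
      constructor <;> nlinarith
  · push_cast at *
    have hlt : 0 < x₁ - x₂ ∨ x₁ = x₂ := by
      rcases lt_or_eq_of_le (show x₂ ≤ x₁ by linarith) with h | h
      · left; linarith
      · right; exact h.symm
    rcases hlt with hlt | rfl
    · refine ⟨(x₁ - (j + 1) * D) / (x₁ - x₂), ⟨div_nonneg (by linarith) hlt.le,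
        (div_le_one hlt).2 (by linarith)⟩, fun σ h0 h1 => ?_, fun σ h0 h1 => ?_⟩
      · rw [le_div_iff₀ hlt] at h1
        constructor <;> nlinarith
      · rw [div_le_iff₀ hlt] at h0
        constructor <;> nlinarith
    · linarith

/-- The columns of cells fit exactly into the grid. -/
theorem floor_div_side {θ : ℝ} (hθ : 1 ≤ θ) {q Q n : ℕ} (hqQ : q ≤ Q) (hn : (n : ℝ) = side θ Q)
    {x : ℝ} (hx0 : 0 ≤ x) (hxn : x < n) :
    0 ≤ ⌊x / side θ q⌋ ∧ ((⌊x / side θ q⌋ : ℝ) + 1) * side θ q ≤ n := by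
  have hD := side_pos hθ q
  refine ⟨Int.floor_nonneg.2 (by positivity), ?_⟩
  obtain ⟨k, rfl⟩ := Nat.exists_eq_add_of_le hqQ
  have e : side θ (q + k) = ((2 ^ (18 * k) : ℤ) : ℝ) * side θ q := by
    unfold side; push_cast; rw [mul_add, pow_add]; ring
  rw [hn, e] at hxn ⊢
  have h1 : ⌊x / side θ q⌋ < 2 ^ (18 * k) := Int.floor_lt.2 ((div_lt_iff₀ hD).2 hxn)
  have h2 : (⌊x / side θ q⌋ : ℝ) + 1 ≤ ((2 ^ (18 * k) : ℤ) : ℝ) := by exact_mod_cast h1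
  exact mul_le_mul_of_nonneg_right h2 hD.le

/-- Every real point of the grid square is close to a vertex. -/
theorem exists_vertex {n : ℕ} {x y : ℝ} (hx0 : 0 ≤ x) (hxn : x < n) (hy0 : 0 ≤ y) (hyn : y < n) :
    ∃ w : Fin n × Fin n, |((lat w).1 : ℝ) - x| ≤ 1 ∧ |((lat w).2 : ℝ) - y| ≤ 1 := by
  obtain ⟨w, hw⟩ := InGrid.exists_lat (n := n) (v := (⌊x⌋, ⌊y⌋))
    ⟨⟨Int.floor_nonneg.2 hx0, Int.floor_lt.2 (by exact_mod_cast hxn)⟩,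
      Int.floor_nonneg.2 hy0, Int.floor_lt.2 (by exact_mod_cast hyn)⟩
  refine ⟨w, ?_⟩
  rw [hw]
  simp only [abs_le]
  have h1 := Int.floor_le x
  have h2 := Int.lt_floor_add_one x
  have h3 := Int.floor_le y
  have h4 := Int.lt_floor_add_one y
  refine ⟨⟨?_, ?_⟩, ?_, ?_⟩ <;> linarith

namespace RoadSystem

variable {θ : ℝ} {Q : ℕ} (R : RoadSystem θ Q)

/-- Vertices whose coordinates differ by at most the side of a cell are joined by travelling
through at most three cells. -/
theorem reach_of_le_side (hθ : 1 ≤ θ) {q n : ℕ} (hq3 : 3 ≤ q) (hqQ : q ≤ Q)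
    (hn : (n : ℝ) = side θ Q) (u v : Fin n × Fin n)
    (h₁ : |((lat u).1 : ℝ) - (lat v).1| ≤ side θ q)
    (h₂ : |((lat u).2 : ℝ) - (lat v).2| ≤ side θ q) :
    R.lines.Reach u v (√((((lat v).1 : ℝ) - (lat u).1) ^ 2 + (((lat v).2 : ℝ) - (lat u).2) ^ 2) +
      9990 * gap θ q) := by
  have hD := side_pos hθ q
  obtain ⟨⟨ux0, uxn⟩, uy0, uyn⟩ := inGrid_lat u
  obtain ⟨⟨vx0, vxn⟩, vy0, vyn⟩ := inGrid_lat v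
  set x₁ : ℝ := ((lat u).1 : ℝ) with hx₁
  set y₁ : ℝ := ((lat u).2 : ℝ) with hy₁
  set x₂ : ℝ := ((lat v).1 : ℝ) with hx₂
  set y₂ : ℝ := ((lat v).2 : ℝ) with hy₂
  have ux0 : 0 ≤ x₁ := by rw [hx₁]; exact_mod_cast ux0
  have uxn : x₁ < n := by rw [hx₁]; exact_mod_cast uxn
  have uy0 : 0 ≤ y₁ := by rw [hy₁]; exact_mod_cast uy0
  have uyn : y₁ < n := by rw [hy₁]; exact_mod_cast uyn
  have vx0 : 0 ≤ x₂ := by rw [hx₂]; exact_mod_cast vx0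
  have vxn : x₂ < n := by rw [hx₂]; exact_mod_cast vxn
  have vy0 : 0 ≤ y₂ := by rw [hy₂]; exact_mod_cast vy0
  have vyn : y₂ < n := by rw [hy₂]; exact_mod_cast vyn
  obtain ⟨i1, i1n⟩ := floor_div_side hθ hqQ hn ux0 uxn
  obtain ⟨j1, j1n⟩ := floor_div_side hθ hqQ hn uy0 uyn
  obtain ⟨i2, i2n⟩ := floor_div_side hθ hqQ hn vx0 vxn
  obtain ⟨j2, j2n⟩ := floor_div_side hθ hqQ hn vy0 vyn
  obtain ⟨τ, ⟨τ0, τ1⟩, τa, τb⟩ := exists_crossing hD h₁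
  obtain ⟨κ, ⟨κ0, κ1⟩, κa, κb⟩ := exists_crossing hD h₂
  set d := √((x₂ - x₁) ^ 2 + (y₂ - y₁) ^ 2) with hd
  have hdist : ∀ σ ρ : ℝ, σ ≤ ρ → √((x₁ + ρ * (x₂ - x₁) - (x₁ + σ * (x₂ - x₁))) ^ 2 +
      (y₁ + ρ * (y₂ - y₁) - (y₁ + σ * (y₂ - y₁))) ^ 2) = (ρ - σ) * d := by
    intro σ ρ h
    have e : (x₁ + ρ * (x₂ - x₁) - (x₁ + σ * (x₂ - x₁))) ^ 2 +
        (y₁ + ρ * (y₂ - y₁) - (y₁ + σ * (y₂ - y₁))) ^ 2 =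
        (ρ - σ) ^ 2 * ((x₂ - x₁) ^ 2 + (y₂ - y₁) ^ 2) := by ring
    rw [e, Real.sqrt_mul (sq_nonneg _), Real.sqrt_sq (sub_nonneg.2 h)]
  have hvert : ∀ σ : ℝ, 0 ≤ σ → σ ≤ 1 → ∃ w : Fin n × Fin n,
      |((lat w).1 : ℝ) - (x₁ + σ * (x₂ - x₁))| ≤ 1 ∧
        |((lat w).2 : ℝ) - (y₁ + σ * (y₂ - y₁))| ≤ 1 := by
    intro σ h0 h1
    have aux : ∀ a b : ℝ, a < n → b < n → a + σ * (b - a) < n := by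
      intro a b ha hb
      rcases le_total a b with hab | hab <;> nlinarith
    exact exists_vertex (by nlinarith) (aux _ _ uxn vxn) (by nlinarith) (aux _ _ uyn vyn)
  have hu1 : |((lat u).1 : ℝ) - (x₁ + 0 * (x₂ - x₁))| ≤ 1 ∧
      |((lat u).2 : ℝ) - (y₁ + 0 * (y₂ - y₁))| ≤ 1 := by simp [← hx₁, ← hy₁]
  have hv1 : |((lat v).1 : ℝ) - (x₁ + 1 * (x₂ - x₁))| ≤ 1 ∧
      |((lat v).2 : ℝ) - (y₁ + 1 * (y₂ - y₁))| ≤ 1 := by simp [← hx₂, ← hy₂]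
  obtain ⟨w, hw⟩ := hvert τ τ0 τ1
  obtain ⟨z, hz⟩ := hvert κ κ0 κ1
  rcases le_total τ κ with h | h
  · have s1 := R.reach_cell hθ hq3 hqQ i1 j1 i1n j1n (τa 0 le_rfl τ0) (κa 0 le_rfl κ0)
      (τa τ τ0 le_rfl) (κa τ τ0 h) hu1 hw
    have s2 := R.reach_cell hθ hq3 hqQ i2 j1 i2n j1n (τb τ le_rfl τ1) (κa τ τ0 h)
      (τb κ h κ1) (κa κ κ0 le_rfl) hw hz
    have s3 := R.reach_cell hθ hq3 hqQ i2 j2 i2n j2n (τb κ h κ1) (κb κ le_rfl κ1)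
      (τb 1 τ1 le_rfl) (κb 1 κ1 le_rfl) hz hv1
    rw [hdist _ _ τ0] at s1
    rw [hdist _ _ h] at s2
    rw [hdist _ _ κ1] at s3
    exact ((s1.trans s2).trans s3).mono (le_of_eq (by ring))
  · have s1 := R.reach_cell hθ hq3 hqQ i1 j1 i1n j1n (τa 0 le_rfl τ0) (κa 0 le_rfl κ0)
      (τa κ κ0 h) (κa κ κ0 le_rfl) hu1 hz
    have s2 := R.reach_cell hθ hq3 hqQ i1 j2 i1n j2n (τa κ κ0 h) (κb κ le_rfl κ1)
      (τa τ τ0 le_rfl) (κb τ h τ1) hz hw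
    have s3 := R.reach_cell hθ hq3 hqQ i2 j2 i2n j2n (τb τ le_rfl τ1) (κb τ h τ1)
      (τb 1 τ1 le_rfl) (κb 1 κ1 le_rfl) hw hv1
    rw [hdist _ _ κ0] at s1
    rw [hdist _ _ h] at s2
    rw [hdist _ _ τ1] at s3
    exact ((s1.trans s2).trans s3).mono (le_of_eq (by ring))

/-- The spacing of level `q + 1` is of the order of the power `8 / 9` of the side of level `q`. -/
theorem gap_le_rpow {θ d : ℝ} (hθ : 1 ≤ θ) (hθ' : θ ≤ 2 ^ 18) {q : ℕ} (hd : side θ q ≤ d) :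
    gap θ (q + 1) ≤ 2 ^ 34 * d ^ (8 / 9 : ℝ) := by
  have h1 : ((2 : ℝ) ^ (2 * q)) ^ 9 ≤ d := by
    refine le_trans ?_ hd
    unfold side
    rw [← pow_mul, show 2 * q * 9 = 18 * q by ring]
    exact le_mul_of_one_le_left (by positivity) hθ
  have h2 : ((2 : ℝ) ^ (2 * q)) ^ 8 ≤ d ^ (8 / 9 : ℝ) := by
    refine le_of_eq_of_le ?_ (Real.rpow_le_rpow (by positivity) h1 (by norm_num))
    rw [← Real.rpow_natCast _ 9, ← Real.rpow_mul (by positivity)]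
    norm_num
  have h3 : gap θ (q + 1) = θ * (2 ^ 16 * ((2 : ℝ) ^ (2 * q)) ^ 8) := by
    unfold gap
    rw [← pow_mul, ← pow_add]; ring_nf
  rw [h3]
  calc θ * (2 ^ 16 * ((2 : ℝ) ^ (2 * q)) ^ 8) ≤ 2 ^ 18 * (2 ^ 16 * d ^ (8 / 9 : ℝ)) := by gcongr
    _ = 2 ^ 34 * d ^ (8 / 9 : ℝ) := by ring

theorem wdist_le (hθ : 1 ≤ θ) (hθ' : θ ≤ 2 ^ 18) {n : ℕ} (hn : (n : ℝ) = side θ Q)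
    (u v : Fin n × Fin n) :
    wdist (grid n) (R.lines.weight n) u v ≤
      ‖pos u - pos v‖ + 2 ^ 60 * ‖pos u - pos v‖ ^ (8 / 9 : ℝ) := by
  rcases eq_or_ne u v with rfl | hne
  · refine (Reach.refl u).wdist_le.trans ?_
    positivity
  have hnorm : ‖pos u - pos v‖ =
      √((((lat v).1 : ℝ) - (lat u).1) ^ 2 + (((lat v).2 : ℝ) - (lat u).2) ^ 2) := by
    rw [norm_pos_sub_pos, norm_sub_rev, Complex.norm_eq_sqrt_sq_add_sq]
    simp [pt]
  set d := ‖pos u - pos v‖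
  have hd1 : |((lat u).1 : ℝ) - (lat v).1| ≤ d := by
    rw [hnorm, abs_sub_comm]
    exact Real.abs_le_sqrt (le_add_of_nonneg_right (sq_nonneg _))
  have hd2 : |((lat u).2 : ℝ) - (lat v).2| ≤ d := by
    rw [hnorm, abs_sub_comm]
    exact Real.abs_le_sqrt (le_add_of_nonneg_left (sq_nonneg _))
  have hd : 1 ≤ d := by
    by_contra! hlt
    have h1 : |(lat u).1 - (lat v).1| < 1 := by exact_mod_cast hd1.trans_lt hlt
    have h2 : |(lat u).2 - (lat v).2| < 1 := by exact_mod_cast hd2.trans_lt hlt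
    rw [Int.abs_lt_one_iff, sub_eq_zero] at h1 h2
    exact hne (lat_injective (Prod.ext h1 h2))
  have hd89 : 1 ≤ d ^ (8 / 9 : ℝ) := Real.one_le_rpow hd (by norm_num)
  set m := max |((lat u).1 : ℝ) - (lat v).1| |((lat u).2 : ℝ) - (lat v).2| with hm
  have hmd : m ≤ d := max_le hd1 hd2
  have hmQ : m ≤ side θ Q := by
    obtain ⟨⟨ux0, uxn⟩, uy0, uyn⟩ := inGrid_lat u
    obtain ⟨⟨vx0, vxn⟩, vy0, vyn⟩ := inGrid_lat v
    rw [← hn]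
    refine max_le ?_ ?_
    · have : |(lat u).1 - (lat v).1| ≤ n := by rw [abs_le]; omega
      exact_mod_cast this
    · have : |(lat u).2 - (lat v).2| ≤ n := by rw [abs_le]; omega
      exact_mod_cast this
  classical
  have hex : ∃ q, m ≤ side θ q := ⟨Q, hmQ⟩
  obtain ⟨q, hq, hqmin⟩ : ∃ q, m ≤ side θ q ∧ ∀ r < q, side θ r < m :=
    ⟨Nat.find hex, Nat.find_spec hex, fun r hr => not_le.1 (Nat.find_min hex hr)⟩
  have hqQ : q ≤ Q := by
    by_contra! h
    exact absurd hmQ (not_le.2 (hqmin Q h))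
  have hm1 : |((lat u).1 : ℝ) - (lat v).1| ≤ m := le_max_left _ _
  have hm2 : |((lat u).2 : ℝ) - (lat v).2| ≤ m := le_max_right _ _
  -- at bounded distance the constant `2 ^ 60` absorbs the cost of any shortest grid path
  rcases lt_or_ge q 3 with hq3 | hq3
  · refine (reach_l1 u v).wdist_le.trans ?_
    have h1 : m ≤ 2 ^ 18 * 2 ^ 36 := by
      refine hq.trans ?_
      unfold side
      have : (2 : ℝ) ^ (18 * q) ≤ 2 ^ 36 := pow_le_pow_right₀ (by norm_num) (by omega)
      gcongr
    norm_num at h1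
    linarith
  · refine (R.reach_of_le_side hθ hq3 hqQ hn u v (hm1.trans hq) (hm2.trans hq)).wdist_le.trans ?_
    rw [← hnorm]
    have h1 := gap_le_rpow hθ hθ' ((hqmin (q - 1) (by omega)).le.trans hmd)
    rw [Nat.sub_add_cancel (by omega)] at h1
    norm_num at h1
    linarith

end RoadSystem
end SquishyGrid

theorem theorem4 :
    ∃ C : ℝ, 0 < C ∧ ∀ n : ℕ, ∃ W : Sym2 (Fin n × Fin n) → ℝ≥0,
      ∀ u v : Fin n × Fin n,
        ‖SquishyGrid.pos u - SquishyGrid.pos v‖ - 1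
            ≤ SquishyGrid.wdist (SquishyGrid.grid n) W u v ∧
          SquishyGrid.wdist (SquishyGrid.grid n) W u v
            ≤ ‖SquishyGrid.pos u - SquishyGrid.pos v‖
              + C * ‖SquishyGrid.pos u - SquishyGrid.pos v‖ ^ (8 / 9 : ℝ) := by
  refine ⟨2 ^ 60, by norm_num, fun n => ?_⟩
  rcases Nat.eq_zero_or_pos n with rfl | hn
  · exact ⟨fun _ => 0, fun u => u.1.elim0⟩
  set Q := Nat.log (2 ^ 18) n
  set θ : ℝ := n / 2 ^ (18 * Q) with hθdef
  have h1 : (2 : ℝ) ^ (18 * Q) ≤ n := by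
    rw [pow_mul]
    exact_mod_cast Nat.pow_log_le_self (2 ^ 18) hn.ne'
  have h2 : (n : ℝ) ≤ 2 ^ 18 * 2 ^ (18 * Q) := by
    rw [pow_mul, mul_comm, ← pow_succ]
    exact_mod_cast (Nat.lt_pow_succ_log_self (show 1 < 2 ^ 18 by norm_num) n).le
  have hθ : 1 ≤ θ := by rw [hθdef, one_le_div (by positivity)]; exact h1
  have hθ' : θ ≤ 2 ^ 18 := by rw [hθdef, div_le_iff₀ (by positivity)]; exact h2
  have hside : (n : ℝ) = SquishyGrid.side θ Q := by
    unfold SquishyGrid.side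
    rw [hθdef]; field_simp
  obtain ⟨R⟩ := SquishyGrid.exists_roadSystem θ Q
  exact ⟨R.lines.weight n, fun u v =>
    ⟨R.lines.norm_sub_one_le_wdist u v, R.wdist_le hθ hθ' hside u v⟩⟩
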